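/- Let $d\ge 1$, $T>0$, and let $D=D'\cap([0,T]\times\mathbb R^d)$ with $D'\subset\mathbb R^{d+1}$ open and connected, be a time-dependent domain whose time sections $D_t=\{z:(t,z)\in D\}$, $t\in[0,T]$, are nonempty, bounded and connected. Write $B_r(z)$ and $S_r(z)$ for the open ball and the sphere in $\mathbb R^d$, and $d(z,E)$ for the Euclidean distance. (Domain.) For $z\in\partial D_t$ let $N_t^1(z)$ be the set of unit vectors $n$ such that $B_\rho(z-\rho n)\cap D_t=\emptyset$ for some $\rho>0$. Assume that there is $r_0>0$ such that for all $t\in[0,T]$ and $z\in\partial D_t$ one has $N^1_t(z)\ne\emptyset$ and $B_{r_0}(z-r_0n)\cap D_t=\emptyset$ for every $n\in N^1_t(z)$. Assume also that $l(r)\to0$ as $r\to0^+$, where $l(r)=\sup_{s,t\in[0,T],|s-t|\le r}\ \sup_{z\in\overline{D_s}}d(z,D_t)$. (Cones.) For $t\in[0,T]$, $z\in\partial D_t$ let $\Gamma_t(z)\subset\mathbb R^d$ be a closed convex cone and $\Gamma^1_t(z)=\Gamma_t(z)\cap S_1(0)$. Assume: (i) $\gamma_1\cdot\gamma_2>-1$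 for all $\gamma_1,\gamma_2\in\Gamma^1_t(z)$; (ii) $\{(t,z,\gamma):t\in[0,T],z\in\partial D_t,\gamma\in\Gamma_t(z)\}$ is closed; (iii) if $s_n\to s$ in $[0,T]$, $z_n\in\partial D_{s_n}$ and $z_n\to z\in\partial D_s$, then the Hausdorff distance between $\Gamma^1_{s_n}(z_n)$ and $\Gamma^1_s(z)$ tends to $0$. (Interaction.) For $s\in[0,T]$, $z\in\partial D_s$, $\rho,\eta>0$, with $t$ ranging over $[s,s+\eta]\cap[0,T]$ and $y$ over $\partial D_t\cap\overline{B_\rho(z)}$, put $$a_{s,z}(\rho,\eta)=\max_{u\in S_1(0)}\min_{t}\min_{y}\min_{\gamma\in\Gamma^1_t(y)}\langle\gamma,u\rangle,$$ $$c_{s,z}(\rho,\eta)=\sup_{t}\sup_{y}\ \sup_{\hat z\in\overline{D_t}\cap\overline{B_\rho(z)},\,\hat z\neq y}\ \sup_{\gamma\in\Gamma^1_t(y)}\Big(\frac{\langle\gamma,y-\hat z\rangle}{|y-\hat z|}\vee0\Big),\qquad e_{s,z}=\frac{c_{s,z}}{a_{s,z}^2\vee (a_{s,z}/2)}.$$ Assume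 that for some $0<\rho_0<r_0$ and $\eta_0>0$, $$\inf_{s\in[0,T]}\inf_{z\in\partial D_s}a_{s,z}(\rho_0,\eta_0)=a>0,\qquad \sup_{s\in[0,T]}\sup_{z\in\partial D_s}e_{s,z}(\rho_0,\eta_0)=e<1.$$ (Good projections.) Assume that for some $0<\delta_0<\rho_0$ and $h_0>1$: for every $t\in[0,T]$ and $y\in\mathbb R^d\setminus\overline{D_t}$ with $d(y,D_t)<\delta_0$ there is $p\in\partial D_t$ with $p-y\in\Gamma_t(p)$ and $|y-p|\le h_0\,d(y,D_t)$. Then for every càdlàg $w:[0,T]\to\mathbb R^d$ with $w_0\in\overline{D_0}$ and $\sup_t|w_t-w_{t^-}|<\frac{\delta_0}{4}\wedge\frac{\rho_0}{4h_0}$ there is a solution $(x,\lambda)$ of the Skorohod problem for $(D,\Gamma,w)$ with $\sup_t|x_t-x_{t^-}|<\rho_0$. That is: $x:[0,T]\to\mathbb R^d$ is càdlàg, $\lambda:[0,T]\to\mathbb R^d$ has bounded variation with total variation measure $d|\lambda|$, and for all $t\in[0,T]$ $$x_t=w_t+\lambda_t,\qquad x_t\in\overline{D_t},\qquad \lambda_t=\int_{[0,t]}\gamma_s\,d|\lambda|_s,$$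 where $\gamma_s\in\Gamma^1_s(x_s)$ for $d|\lambda|$-a.e. $s$ with $x_s\in\partial D_s$, and $d|\lambda|(\{t\in[0,T]:(t,x_t)\in D\})=0$. -/

import Mathlib

open Set Filter Topology MeasureTheory Metric
open scoped ENNReal

noncomputable section

namespace Skorohod

/-- `ℝ^d` with the Euclidean norm and inner product. -/
abbrev Euc (d : ℕ) := EuclideanSpace ℝ (Fin d)

variable {d : ℕ}

/-! ### Càdlàg functions on `[0,T]` and their jumps -/

/-- `w` restricted to `[0,T]` is right continuous with left limits. The values of `w` outside
`[0,T]` play no role. -/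
structure IsCadlag (T : ℝ) (w : ℝ → Euc d) : Prop where
  right_continuous : ∀ t ∈ Ico 0 T, ContinuousWithinAt w (Ioi t) t
  left_limit : ∀ t ∈ Ioc 0 T, ∃ l, Tendsto w (𝓝[<] t) (𝓝 l)

/-- `w` is càdlàg on `[0,T]` and `sup_t |w_t - w_{t-}| < δ` (there is no jump at time `0`). -/
def IsCadlagWithJumpsBelow (T δ : ℝ) (w : ℝ → Euc d) : Prop :=
  IsCadlag T w ∧
    ∃ c < δ, ∀ t ∈ Ioc 0 T, ∀ l, Tendsto w (𝓝[<] t) (𝓝 l) → ‖w t - l‖ ≤ c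

/-! ### Total variation -/

/-- The total variation of `f` over `[0, t ∧ T]` (zero for `t < 0`). -/
def totalVariation (T : ℝ) (f : ℝ → Euc d) (t : ℝ) : ℝ :=
  (eVariationOn f (Icc 0 (min t T))).toReal

theorem totalVariation_monotone {T : ℝ} {f : ℝ → Euc d}
    (hf : BoundedVariationOn f (Icc 0 T)) : Monotone (totalVariation T f) := by
  intro s t hst
  refine ENNReal.toReal_mono ?_ (eVariationOn.mono f ?_)
  · exact ((eVariationOn.mono f (Icc_subset_Icc_right (min_le_right t T))).trans_lt
      (lt_top_iff_ne_top.2 hf)).ne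
  · exact Icc_subset_Icc_right (min_le_min_right T hst)

open scoped Classical in
/-- The measure `d|f|` on `ℝ`: the Stieltjes measure of the total variation function of a function
`f` of bounded variation on `[0,T]`. It is carried by `[0,T]`, and by `(0,T]` when `f` is right
continuous at `0`. -/
def variationMeasure (T : ℝ) (f : ℝ → Euc d) : Measure ℝ :=
  if hf : BoundedVariationOn f (Icc 0 T) then
    (totalVariation_monotone hf).stieltjesFunction.measure
  else 0

/-! ### Time-dependent domains -/

/-- The time section `D_t`. -/
def slice (D : Set (ℝ × Euc d)) (t : ℝ) : Set (Euc d) := {z | (t, z) ∈ D}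

/-- The boundary `∂D_t` of the time section, taken in `ℝ^d`. -/
def bdry (D : Set (ℝ × Euc d)) (t : ℝ) : Set (Euc d) := frontier (slice D t)

/-- Time-dependent domains over `[0,T]` with nonempty, bounded, connected time sections. -/
structure IsTimeDependentDomain (T : ℝ) (D : Set (ℝ × Euc d)) : Prop where
  exists_open : ∃ D' : Set (ℝ × Euc d), IsOpen D' ∧ IsConnected D' ∧ D = D' ∩ Icc 0 T ×ˢ univ
  slice_nonempty : ∀ t ∈ Icc 0 T, (slice D t).Nonempty
  slice_bounded : ∀ t ∈ Icc 0 T, Bornology.IsBounded (slice D t)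
  slice_connected : ∀ t ∈ Icc 0 T, IsConnected (slice D t)

/-- The cone `N_t(z)` of inward normal vectors at `z`. -/
def inwardNormals (D : Set (ℝ × Euc d)) (t : ℝ) (z : Euc d) : Set (Euc d) :=
  {0} ∪ {v | v ≠ 0 ∧ ∃ ρ > 0, ball (z - (ρ / ‖v‖) • v) ρ ⊆ (slice D t)ᶜ}

/-- The unit inward normal vectors `N_t^1(z)`. -/
def unitInwardNormals (D : Set (ℝ × Euc d)) (t : ℝ) (z : Euc d) : Set (Euc d) :=
  inwardNormals D t z ∩ sphere 0 1

/-- The uniform exterior sphere condition in time with radius `r₀`: every boundary point of every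
time section has an inward unit normal, and for each such normal the exterior ball can be chosen
of radius `r₀`. -/
def UniformExteriorSphere (T r₀ : ℝ) (D : Set (ℝ × Euc d)) : Prop :=
  0 < r₀ ∧ ∀ t ∈ Icc 0 T, ∀ z ∈ bdry D t,
    (unitInwardNormals D t z).Nonempty ∧
      ∀ n ∈ unitInwardNormals D t z, ball (z - r₀ • n) r₀ ⊆ (slice D t)ᶜ

/-- The modulus of continuity `l(r)` of the variation of `D` in time, with values in `[0,∞]`. -/
def timeModulus (T : ℝ) (D : Set (ℝ × Euc d)) (r : ℝ) : ℝ≥0∞ :=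
  ⨆ (s ∈ Icc 0 T) (t ∈ Icc 0 T) (_ : |s - t| ≤ r) (z ∈ closure (slice D s)),
    infEDist z (slice D t)

/-! ### Cones of reflection -/

/-- Closed convex cones of vectors in `ℝ^d`. -/
structure IsClosedConvexCone (C : Set (Euc d)) : Prop where
  nonempty : C.Nonempty
  closed : IsClosed C
  combination : ∀ α β : ℝ, 0 ≤ α → 0 ≤ β → ∀ u ∈ C, ∀ v ∈ C, α • u + β • v ∈ C

/-- The unit vectors `Γ_t^1(z)` of the cone `Γ_t(z)`. -/
def unitVectors (Γ : ℝ → Euc d → Set (Euc d)) (t : ℝ) (z : Euc d) : Set (Euc d) :=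
  Γ t z ∩ sphere 0 1

/-- No cone contains vectors in opposite directions. -/
def NoOppositeVectors (T : ℝ) (D : Set (ℝ × Euc d)) (Γ : ℝ → Euc d → Set (Euc d)) : Prop :=
  ∀ t ∈ Icc 0 T, ∀ z ∈ bdry D t, ∀ γ₁ ∈ unitVectors Γ t z, ∀ γ₂ ∈ unitVectors Γ t z,
    -1 < inner ℝ γ₁ γ₂

/-- The graph of `Γ` over the boundaries of the time sections. -/
def coneGraph (T : ℝ) (D : Set (ℝ × Euc d)) (Γ : ℝ → Euc d → Set (Euc d)) :
    Set (ℝ × Euc d × Euc d) :=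
  {p | p.1 ∈ Icc 0 T ∧ p.2.1 ∈ bdry D p.1 ∧ p.2.2 ∈ Γ p.1 p.2.1}

/-- The cones vary continuously along the boundaries of the time sections. Since the Hausdorff
distance of two different closed cones is infinite, it is measured on their unit vectors. -/
def ConesContinuous (T : ℝ) (D : Set (ℝ × Euc d)) (Γ : ℝ → Euc d → Set (Euc d)) : Prop :=
  ∀ (s : ℕ → ℝ) (z : ℕ → Euc d) (s' : ℝ) (z' : Euc d),
    (∀ n, s n ∈ Icc 0 T) → (∀ n, z n ∈ bdry D (s n)) → s' ∈ Icc 0 T → z' ∈ bdry D s' →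
    Tendsto s atTop (𝓝 s') → Tendsto z atTop (𝓝 z') →
    Tendsto (fun n => hausdorffEDist (unitVectors Γ (s n) (z n)) (unitVectors Γ s' z'))
      atTop (𝓝 0)

/-! ### Interaction between the domain and the cones

If `D` is a time-dependent domain over `[0,T]`, then its sections at times `t > T` are empty, so
only the times `t ∈ [s, s + η] ∩ [0,T]` contribute below. -/

/-- All unit reflection vectors at boundary points near `z` at times in `[s, s + η]`. -/
def nearbyUnitVectors (D : Set (ℝ × Euc d)) (Γ : ℝ → Euc d → Set (Euc d))
    (s : ℝ) (z : Euc d) (ρ η : ℝ) : Set (Euc d) :=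
  {γ | ∃ t ∈ Icc s (s + η), ∃ y ∈ bdry D t ∩ closedBall z ρ, γ ∈ unitVectors Γ t y}

/-- The quantity `a_{s,z}(ρ,η)`. -/
def aCoeff (D : Set (ℝ × Euc d)) (Γ : ℝ → Euc d → Set (Euc d))
    (s : ℝ) (z : Euc d) (ρ η : ℝ) : ℝ :=
  sSup ((fun u => sInf ((fun γ => inner ℝ γ u) '' nearbyUnitVectors D Γ s z ρ η)) ''
    sphere (0 : Euc d) 1)

/-- The quantity `c_{s,z}(ρ,η)`. -/
def cCoeff (D : Set (ℝ × Euc d)) (Γ : ℝ → Euc d → Set (Euc d))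
    (s : ℝ) (z : Euc d) (ρ η : ℝ) : ℝ :=
  sSup {r | ∃ t ∈ Icc s (s + η), ∃ y ∈ bdry D t ∩ closedBall z ρ,
    ∃ x ∈ closure (slice D t) ∩ closedBall z ρ, x ≠ y ∧
      ∃ γ ∈ unitVectors Γ t y, r = max (inner ℝ γ (y - x) / ‖y - x‖) 0}

/-- The quantity `e_{s,z}(ρ,η)`. -/
def eCoeff (D : Set (ℝ × Euc d)) (Γ : ℝ → Euc d → Set (Euc d))
    (s : ℝ) (z : Euc d) (ρ η : ℝ) : ℝ :=
  cCoeff D Γ s z ρ η / max (aCoeff D Γ s z ρ η ^ 2) (aCoeff D Γ s z ρ η / 2)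

/-- The values of a quantity `q_{s,z}` over all `s ∈ [0,T]` and `z ∈ ∂D_s`. -/
def boundaryValues (T : ℝ) (D : Set (ℝ × Euc d)) (q : ℝ → Euc d → ℝ) : Set ℝ :=
  {r | ∃ s ∈ Icc 0 T, ∃ z ∈ bdry D s, r = q s z}

/-- The `(δ₀,h₀)`-property of good projections along `Γ`: every `y` outside `closure D_t` at
distance less than `δ₀` from `D_t` can be moved along a vector of `Γ_t(p)` to a point `p ∈ ∂D_t`
with `|y - p| ≤ h₀ d(y, D_t)`. -/
def GoodProjections (T δ₀ h₀ : ℝ) (D : Set (ℝ × Euc d)) (Γ : ℝ → Euc d → Set (Euc d)) : Prop :=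
  ∀ t ∈ Icc 0 T, ∀ y ∉ closure (slice D t), infDist y (slice D t) < δ₀ →
    ∃ p ∈ bdry D t, p - y ∈ Γ t p ∧ ‖y - p‖ ≤ h₀ * infDist y (slice D t)

/-! ### The Skorohod problem -/

/-- `(x, l)` is a solution to the Skorohod problem for `(D, Γ, w)` on `[0,T]`. -/
structure IsSkorohodSolution (T : ℝ) (D : Set (ℝ × Euc d)) (Γ : ℝ → Euc d → Set (Euc d))
    (w x l : ℝ → Euc d) : Prop where
  cadlag : IsCadlag T x
  boundedVariation : BoundedVariationOn l (Icc 0 T)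
  decomposition : ∀ t ∈ Icc 0 T, x t = w t + l t
  mem_closure : ∀ t ∈ Icc 0 T, x t ∈ closure (slice D t)
  reflection : ∃ γ : ℝ → Euc d,
    IntegrableOn γ (Icc 0 T) (variationMeasure T l) ∧
    (∀ t ∈ Icc 0 T, l t = ∫ s in Icc 0 t, γ s ∂(variationMeasure T l)) ∧
    ∀ᵐ s ∂((variationMeasure T l).restrict (Icc 0 T)),
      x s ∈ bdry D s → γ s ∈ unitVectors Γ s (x s)
  no_push_inside : variationMeasure T l {t | t ∈ Icc 0 T ∧ (t, x t) ∈ D} = 0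

end Skorohod

end

/-!
The solution is a limit of discrete solutions. Along a finite set of times, `w` is followed by its
increments, and whenever the position leaves the closed time section it is brought back to the
boundary along the cone, by a good projection; this is possible because the jumps of `w` and the
variation of the time sections between consecutive times are small.

The crucial point is a bound on the variation of the discrete reflection terms which does not
depend on the set of times (`IsScheme.seqVariation_le`). Near a boundary point all reflection
vectors make an acute angle with a common direction, with cosine at least `a`, so that the variation
of the reflection is at most `1 / a` times its increment. On the other hand, the squared norm of the
increment is controlled by an energy identity, in which the scalar products of the reflection
vectors with the displacement are bounded in terms of `c_{s,z}`; as `e < 1`, this can be absorbed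
(`sum_norm_sub_le_of_energy`). Hence the variation is at most a constant times the oscillation of
`w` and of the time sections, as long as the position stays near the boundary point, and this very
bound prevents it from moving away.

A càdlàg function has small oscillation between the points of a suitable finite set, so along
increasing sets of times the discrete solutions have uniformly bounded variation and a common
modulus of regularity (`exists_isApproximation`). They converge pointwise along an ultrafilter, and
the limit inherits both properties.

The limit `l` has a polar decomposition `dl = γ d|l|` with `‖γ‖ = 1` (`exists_polar`). It remains to
see that `γ_s` lies in the cone at `x_s`, and that `x_s` is a boundary point, for almost every `s`
(`IsApproximation.ae_mem_coneGraph`). If `s` belongs to one of the sets of times and carries mass,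
the jump of `l` at `s` is the limit of the jumps of the discrete solutions, and the graph of the
cones is closed. If `s` belongs to none of them, the discrete reflection vectors at times near `s`
are close to the cone at `x_s`, again because the graph is closed; as the variation is comparable to
the increments, the increments of `l` near `s` are relatively close to the cone, and so is `γ_s` by
Lebesgue differentiation with respect to `d|l|`.
-/

noncomputable section

namespace Skorohod

variable {d : ℕ}

/-! ### An energy estimate for sequences in an inner product space -/

theorem norm_le_sum_norm_sub {E : Type*} [SeminormedAddCommGroup E] {v : ℕ → E}
    (h0 : v 0 = 0) (j : ℕ) :
    ‖v j‖ ≤ ∑ k ∈ Finset.range j, ‖v (k + 1) - v k‖ := by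
  have := Finset.sum_range_sub v j
  rw [h0, sub_zero] at this
  rw [← this]
  exact norm_sum_le _ _

section Energy

variable {E : Type*} [NormedAddCommGroup E] [InnerProductSpace ℝ E]

theorem norm_sq_succ_eq (v : ℕ → E) (k : ℕ) :
    ‖v (k + 1)‖ ^ 2 =
      ‖v k‖ ^ 2 + 2 * inner ℝ (v (k + 1)) (v (k + 1) - v k) - ‖v (k + 1) - v k‖ ^ 2 := by
  rw [inner_sub_right, norm_sub_sq_real, real_inner_self_eq_norm_sq]
  ring

/-- The alternative `max (α ^ 2) (α / 2)` reflects two ways to use the energy identity: with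
`α ^ 2` the energy is bounded by the square of the variation, with `α / 2` by the variation times
the largest norm. -/
theorem sum_norm_sub_le_of_energy {v : ℕ → E} {n : ℕ} {α b c e : ℝ} (h0 : v 0 = 0) (hα : 0 < α)
    (hb : 0 ≤ b) (hc0 : 0 ≤ c) (hc1 : c ≤ 1) (he : e < 1) (hce : c ≤ e * max (α ^ 2) (α / 2))
    (hin : ∀ k < n, inner ℝ (v (k + 1)) (v (k + 1) - v k) ≤
      (c * ‖v (k + 1)‖ + b) * ‖v (k + 1) - v k‖)
    (hlow : ∀ j ≤ n, α * ∑ k ∈ Finset.range j, ‖v (k + 1) - v k‖ ≤ ‖v j‖) :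
    α ^ 2 * (1 - e) * ∑ k ∈ Finset.range n, ‖v (k + 1) - v k‖ ≤ 2 * b := by
  set V : ℕ → ℝ := fun j => ∑ k ∈ Finset.range j, ‖v (k + 1) - v k‖ with hV
  have hVs : ∀ j, V (j + 1) = V j + ‖v (j + 1) - v j‖ := fun j => Finset.sum_range_succ _ _
  have hV0 : ∀ j, 0 ≤ V j := fun j => Finset.sum_nonneg fun _ _ => norm_nonneg _
  change α ^ 2 * (1 - e) * V n ≤ 2 * b
  rcases le_total (α / 2) (α ^ 2) with hcase | hcase
  · rw [max_eq_left hcase] at hce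
    -- the term `-‖v (k + 1) - v k‖ ^ 2` of the energy identity absorbs the discretization error
    -- of the square of the variation, because `c ≤ 1`
    have key : ∀ j ≤ n, ‖v j‖ ^ 2 ≤ c * V j ^ 2 + 2 * b * V j := by
      intro j
      induction j with
      | zero => intro _; simp [h0, hV]
      | succ j ih =>
        intro hj
        have h1 := ih (by omega)
        have h2 := hin j (by omega)
        have h3 : ‖v (j + 1)‖ ≤ V j + ‖v (j + 1) - v j‖ := by
          rw [← hVs]; exact norm_le_sum_norm_sub h0 _
        rw [norm_sq_succ_eq, hVs]
        have hn := norm_nonneg (v (j + 1) - v j)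
        have h4 : (c * ‖v (j + 1)‖ + b) * ‖v (j + 1) - v j‖ ≤
            (c * (V j + ‖v (j + 1) - v j‖) + b) * ‖v (j + 1) - v j‖ := by gcongr
        nlinarith [mul_nonneg (sub_nonneg.2 hc1) (sq_nonneg ‖v (j + 1) - v j‖)]
    have h1 := key n le_rfl
    have h2 := hlow n le_rfl
    have h3 : (α * V n) ^ 2 ≤ c * V n ^ 2 + 2 * b * V n :=
      (pow_le_pow_left₀ (mul_nonneg hα.le (hV0 n)) h2 2).trans h1
    rcases (hV0 n).eq_or_lt with h | h
    · rw [← h]; linarith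
    · have h4 : c * V n ^ 2 ≤ e * α ^ 2 * V n ^ 2 := by gcongr
      refine le_of_mul_le_mul_right ?_ h
      nlinarith
  · rw [max_eq_right hcase] at hce
    obtain ⟨m, hm, hmax⟩ :=
      Finset.exists_max_image (Finset.range (n + 1)) (fun k => ‖v k‖) ⟨0, by simp⟩
    have hmn : m ≤ n := by simpa [Nat.lt_succ_iff] using hm
    have key : ∀ j ≤ n, ‖v j‖ ^ 2 ≤ 2 * (c * ‖v m‖ + b) * V j := by
      intro j
      induction j with
      | zero => intro _; simp [h0, hV]
      | succ j ih =>
        intro hj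
        have h1 := ih (by omega)
        have h2 := hin j (by omega)
        have h3 : ‖v (j + 1)‖ ≤ ‖v m‖ := hmax (j + 1) (by simp; omega)
        have h4 : (c * ‖v (j + 1)‖ + b) * ‖v (j + 1) - v j‖ ≤
            (c * ‖v m‖ + b) * ‖v (j + 1) - v j‖ := by gcongr
        rw [norm_sq_succ_eq, hVs]
        nlinarith [sq_nonneg ‖v (j + 1) - v j‖]
    have h1 := key m hmn
    have h2 := hlow m hmn
    have h3 : α * (1 - e) * ‖v m‖ ≤ 2 * b := by
      rcases (norm_nonneg (v m)).eq_or_lt with h | h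
      · rw [← h]; linarith
      · refine le_of_mul_le_mul_right ?_ h
        have h4 : 2 * (c * ‖v m‖ + b) * (α * V m) ≤ 2 * (c * ‖v m‖ + b) * ‖v m‖ := by
          gcongr
        have h5 : c * ‖v m‖ ^ 2 ≤ e * (α / 2) * ‖v m‖ ^ 2 := by gcongr
        nlinarith
    have h4 : α * V n ≤ ‖v m‖ := (hlow n le_rfl).trans (hmax n (by simp))
    have h5 : α * (1 - e) * (α * V n) ≤ α * (1 - e) * ‖v m‖ :=
      mul_le_mul_of_nonneg_left h4 (mul_nonneg hα.le (by linarith))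
    nlinarith

end Energy

/-! ### Interaction between the domain and the cones -/

/-- The quantitative content of the assumptions on `a_{s,z}` and `e_{s,z}`: near every boundary
point there are a direction `u` with which all unit reflection vectors make an angle with cosine
at least `α ≥ a`, and a constant `c ≤ e (α² ∨ α/2)` which controls how far the domain is from
lying on the inner side of the reflection vectors. -/
def UniformInteraction (T : ℝ) (D : Set (ℝ × Euc d)) (Γ : ℝ → Euc d → Set (Euc d))
    (ρ η a e : ℝ) : Prop :=
  ∀ s ∈ Icc 0 T, ∀ z ∈ bdry D s, ∃ α c : ℝ, ∃ u : Euc d, a ≤ α ∧ 0 ≤ c ∧ c ≤ 1 ∧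
    c ≤ e * max (α ^ 2) (α / 2) ∧ ‖u‖ = 1 ∧
    ∀ t ∈ Icc s (s + η), ∀ y ∈ bdry D t ∩ closedBall z ρ, ∀ γ ∈ unitVectors Γ t y,
      α ≤ inner ℝ γ u ∧
      ∀ x ∈ closure (slice D t) ∩ closedBall z ρ, inner ℝ γ (y - x) ≤ c * ‖y - x‖

theorem norm_of_mem_unitVectors {Γ : ℝ → Euc d → Set (Euc d)} {t : ℝ} {z γ : Euc d}
    (h : γ ∈ unitVectors Γ t z) : ‖γ‖ = 1 := by
  simpa using h.2

theorem norm_of_mem_nearbyUnitVectors {D : Set (ℝ × Euc d)} {Γ : ℝ → Euc d → Set (Euc d)}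
    {s ρ η : ℝ} {z γ : Euc d} (h : γ ∈ nearbyUnitVectors D Γ s z ρ η) : ‖γ‖ = 1 := by
  obtain ⟨t, -, y, -, h⟩ := h
  exact norm_of_mem_unitVectors h

theorem abs_inner_le_of_norm_eq_one {γ v : Euc d} (h : ‖γ‖ = 1) : |inner ℝ γ v| ≤ ‖v‖ := by
  simpa [h] using abs_real_inner_le_norm γ v

theorem bddBelow_inner_image {S : Set (Euc d)} (hS : ∀ γ ∈ S, ‖γ‖ = 1) (u : Euc d) :
    BddBelow ((fun γ => inner ℝ γ u) '' S) := by
  refine ⟨-‖u‖, ?_⟩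
  rintro _ ⟨γ, hγ, rfl⟩
  exact (abs_le.1 (abs_inner_le_of_norm_eq_one (hS γ hγ))).1

/-- The supremum over `u` in the definition of `a_{s,z}` is attained. -/
theorem exists_unit_aCoeff_le {D : Set (ℝ × Euc d)} {Γ : ℝ → Euc d → Set (Euc d)}
    {s ρ η : ℝ} {z : Euc d} (hd : 1 ≤ d) :
    ∃ u : Euc d, ‖u‖ = 1 ∧
      ∀ γ ∈ nearbyUnitVectors D Γ s z ρ η, aCoeff D Γ s z ρ η ≤ inner ℝ γ u := by
  set S := nearbyUnitVectors D Γ s z ρ η with hS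
  have hS1 : ∀ γ ∈ S, ‖γ‖ = 1 := fun γ hγ => norm_of_mem_nearbyUnitVectors hγ
  have : Nonempty (Fin d) := ⟨⟨0, hd⟩⟩
  have hne : (sphere (0 : Euc d) 1).Nonempty := NormedSpace.sphere_nonempty.2 zero_le_one
  have hcont : Continuous fun u : Euc d => sInf ((fun γ => inner ℝ γ u) '' S) := by
    rcases S.eq_empty_or_nonempty with h | h
    · simp only [h, image_empty]; exact continuous_const
    · refine LipschitzWith.continuous (K := 1) (LipschitzWith.of_le_add fun u v => ?_)
      rw [← sub_le_iff_le_add]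
      refine le_csInf (h.image _) ?_
      rintro _ ⟨γ, hγ, rfl⟩
      have h1 : sInf ((fun γ => inner ℝ γ u) '' S) ≤ inner ℝ γ u :=
        csInf_le (bddBelow_inner_image hS1 u) ⟨γ, hγ, rfl⟩
      have h2 := (abs_le.1 (abs_inner_le_of_norm_eq_one (v := u - v) (hS1 γ hγ))).2
      rw [inner_sub_right] at h2
      rw [dist_eq_norm]
      change _ ≤ inner ℝ γ v
      linarith
  obtain ⟨u, hu, hmax⟩ := (isCompact_sphere (0 : Euc d) 1).exists_isMaxOn hne hcont.continuousOn
  refine ⟨u, by simpa using hu, fun γ hγ => ?_⟩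
  refine (csSup_le (hne.image _) ?_).trans (csInf_le (bddBelow_inner_image hS1 u) ⟨γ, hγ, rfl⟩)
  rintro _ ⟨v, hv, rfl⟩
  exact hmax hv

theorem cCoeff_mem_Icc {D : Set (ℝ × Euc d)} {Γ : ℝ → Euc d → Set (Euc d)}
    {s ρ η : ℝ} {z : Euc d} : cCoeff D Γ s z ρ η ∈ Icc 0 1 := by
  constructor
  · refine Real.sSup_nonneg ?_
    rintro _ ⟨t, -, y, -, x, -, -, γ, -, rfl⟩
    exact le_max_right _ _
  · refine Real.sSup_le ?_ zero_le_one
    rintro _ ⟨t, -, y, -, x, -, -, γ, hγ, rfl⟩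
    refine max_le (div_le_one_of_le₀ ?_ (norm_nonneg _)) zero_le_one
    exact (le_abs_self _).trans (abs_inner_le_of_norm_eq_one (norm_of_mem_unitVectors hγ))

theorem inner_le_cCoeff_mul {D : Set (ℝ × Euc d)} {Γ : ℝ → Euc d → Set (Euc d)}
    {s t ρ η : ℝ} {x y z γ : Euc d} (ht : t ∈ Icc s (s + η)) (hy : y ∈ bdry D t ∩ closedBall z ρ)
    (hγ : γ ∈ unitVectors Γ t y) (hx : x ∈ closure (slice D t) ∩ closedBall z ρ) :
    inner ℝ γ (y - x) ≤ cCoeff D Γ s z ρ η * ‖y - x‖ := by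
  rcases eq_or_ne x y with rfl | hxy
  · simp
  have hpos : 0 < ‖y - x‖ := norm_pos_iff.2 (sub_ne_zero.2 hxy.symm)
  rw [← div_le_iff₀ hpos]
  refine (le_max_left _ 0).trans (le_csSup ⟨1, ?_⟩ ⟨t, ht, y, hy, x, hx, hxy, γ, hγ, rfl⟩)
  rintro _ ⟨t, -, y, -, x, -, -, γ, hγ, rfl⟩
  refine max_le (div_le_one_of_le₀ ?_ (norm_nonneg _)) zero_le_one
  exact (le_abs_self _).trans (abs_inner_le_of_norm_eq_one (norm_of_mem_unitVectors hγ))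

theorem uniformInteraction {T : ℝ} {D : Set (ℝ × Euc d)} {Γ : ℝ → Euc d → Set (Euc d)}
    {ρ η a e : ℝ} (hd : 1 ≤ d)
    (ha : a ∈ lowerBounds (boundaryValues T D fun s z => aCoeff D Γ s z ρ η)) (ha_pos : 0 < a)
    (he : e ∈ upperBounds (boundaryValues T D fun s z => eCoeff D Γ s z ρ η)) :
    UniformInteraction T D Γ ρ η a e := by
  intro s hs z hz
  obtain ⟨u, hu, hua⟩ := exists_unit_aCoeff_le (D := D) (Γ := Γ) (s := s) (ρ := ρ) (η := η)
    (z := z) hd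
  have haα : a ≤ aCoeff D Γ s z ρ η := ha ⟨s, hs, z, hz, rfl⟩
  have hec : eCoeff D Γ s z ρ η ≤ e := he ⟨s, hs, z, hz, rfl⟩
  have hα : 0 < aCoeff D Γ s z ρ η := ha_pos.trans_le haα
  refine ⟨aCoeff D Γ s z ρ η, cCoeff D Γ s z ρ η, u, haα, cCoeff_mem_Icc.1, cCoeff_mem_Icc.2, ?_,
    hu, fun t ht y hy γ hγ => ⟨hua γ ⟨t, ht, y, hy, hγ⟩,
      fun x hx => inner_le_cCoeff_mul ht hy hγ hx⟩⟩
  rwa [eCoeff, div_le_iff₀ (lt_max_of_lt_left (by positivity))] at hec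

/-! ### Discrete reflection schemes -/

/-- A discrete solution along the times `τ 0, τ 1, …`: after each increment of `w` the position
`x k`, if it has left the closed time section, is brought back to its boundary along the cone.
`l k` is the accumulated reflection, and each reflection is at most `h` times the distance to the
time section. -/
structure IsScheme (D : Set (ℝ × Euc d)) (Γ : ℝ → Euc d → Set (Euc d)) (w : ℝ → Euc d) (h : ℝ)
    (τ : ℕ → ℝ) (x l : ℕ → Euc d) : Prop where
  decomposition : ∀ k, x k = w (τ k) + l k
  zero : l 0 = 0
  mem_closure : ∀ k, x k ∈ closure (slice D (τ k))
  reflection : ∀ k, l (k + 1) ≠ l k →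
    x (k + 1) ∈ bdry D (τ (k + 1)) ∧ l (k + 1) - l k ∈ Γ (τ (k + 1)) (x (k + 1))
  norm_le : ∀ k, ‖l (k + 1) - l k‖ ≤
    h * infDist (x k + (w (τ (k + 1)) - w (τ k))) (slice D (τ (k + 1)))

/-- Between the indices `i` and `j` little time passes, and `w` and the time sections of `D`
move by at most `ε`. -/
structure IsQuiet (D : Set (ℝ × Euc d)) (w : ℝ → Euc d) (η ε : ℝ) (τ : ℕ → ℝ) (i j : ℕ) :
    Prop where
  time : ∀ k k', i ≤ k → k ≤ k' → k' ≤ j → τ k' ∈ Icc (τ k) (τ k + η)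
  osc : ∀ k ∈ Icc i j, ∀ k' ∈ Icc i j, ‖w (τ k) - w (τ k')‖ ≤ ε
  slices : ∀ k ∈ Icc i j, ∀ k' ∈ Icc i j, ∀ z ∈ closure (slice D (τ k)),
    ∃ z' ∈ slice D (τ k'), dist z z' ≤ ε

/-- The variation of a sequence between the indices `i` and `j`. -/
def seqVariation (l : ℕ → Euc d) (i j : ℕ) : ℝ := ∑ k ∈ Finset.Ico i j, ‖l (k + 1) - l k‖

theorem seqVariation_nonneg (l : ℕ → Euc d) (i j : ℕ) : 0 ≤ seqVariation l i j :=
  Finset.sum_nonneg fun _ _ => norm_nonneg _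

theorem seqVariation_add (l : ℕ → Euc d) {i j k : ℕ} (hij : i ≤ j) (hjk : j ≤ k) :
    seqVariation l i j + seqVariation l j k = seqVariation l i k :=
  Finset.sum_Ico_consecutive _ hij hjk

theorem seqVariation_succ (l : ℕ → Euc d) (i : ℕ) :
    seqVariation l i (i + 1) = ‖l (i + 1) - l i‖ := by
  simp [seqVariation]

theorem norm_sub_le_seqVariation (l : ℕ → Euc d) {i j : ℕ} (hij : i ≤ j) :
    ‖l j - l i‖ ≤ seqVariation l i j := by
  rw [← Finset.sum_Ico_sub l hij]
  exact norm_sum_le _ _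

theorem IsClosedConvexCone.smul_mem {C : Set (Euc d)} (hC : IsClosedConvexCone C) {r : ℝ}
    (hr : 0 ≤ r) {v : Euc d} (hv : v ∈ C) : r • v ∈ C := by
  simpa using hC.combination r 0 hr le_rfl v hv v hv

theorem IsClosedConvexCone.add_mem {C : Set (Euc d)} (hC : IsClosedConvexCone C)
    {u v : Euc d} (hu : u ∈ C) (hv : v ∈ C) : u + v ∈ C := by
  simpa using hC.combination 1 1 zero_le_one zero_le_one u hu v hv

theorem IsClosedConvexCone.zero_mem {C : Set (Euc d)} (hC : IsClosedConvexCone C) :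
    (0 : Euc d) ∈ C := by
  obtain ⟨v, hv⟩ := hC.nonempty
  simpa using hC.smul_mem le_rfl hv

section Scheme

variable {T : ℝ} {D : Set (ℝ × Euc d)} {Γ : ℝ → Euc d → Set (Euc d)} {w : ℝ → Euc d} {h : ℝ}
  {τ : ℕ → ℝ} {x l : ℕ → Euc d} {η ε : ℝ} {i j : ℕ}

theorem IsQuiet.mono (hq : IsQuiet D w η ε τ i j) {i' j' : ℕ} (hi : i ≤ i') (hj : j' ≤ j) :
    IsQuiet D w η ε τ i' j' where
  time k k' h1 h2 h3 := hq.time k k' (hi.trans h1) h2 (h3.trans hj)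
  osc k hk k' hk' := hq.osc k ⟨hi.trans hk.1, hk.2.trans hj⟩ k' ⟨hi.trans hk'.1, hk'.2.trans hj⟩
  slices k hk k' hk' :=
    hq.slices k ⟨hi.trans hk.1, hk.2.trans hj⟩ k' ⟨hi.trans hk'.1, hk'.2.trans hj⟩

namespace IsScheme

/-- The unit direction of a nontrivial reflection step. -/
theorem exists_unitVector (hs : IsScheme D Γ w h τ x l)
    (hΓ : ∀ t ∈ Icc 0 T, ∀ z ∈ bdry D t, IsClosedConvexCone (Γ t z)) (hτ : ∀ k, τ k ∈ Icc 0 T)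
    {k : ℕ} (hk : l (k + 1) ≠ l k) :
    ∃ γ ∈ unitVectors Γ (τ (k + 1)) (x (k + 1)), l (k + 1) - l k = ‖l (k + 1) - l k‖ • γ := by
  have hpos : ‖l (k + 1) - l k‖ ≠ 0 := norm_ne_zero_iff.2 (sub_ne_zero.2 hk)
  obtain ⟨hb, hΔ⟩ := hs.reflection k hk
  refine ⟨‖l (k + 1) - l k‖⁻¹ • (l (k + 1) - l k),
    ⟨(hΓ _ (hτ _) _ hb).smul_mem (by positivity) hΔ, ?_⟩, ?_⟩
  · rw [mem_sphere_zero_iff_norm, norm_smul, norm_inv, norm_norm, inv_mul_cancel₀ hpos]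
  · rw [smul_smul, mul_inv_cancel₀ hpos, one_smul]

theorem norm_step_le (hs : IsScheme D Γ w h τ x l) (hh : 0 ≤ h)
    (hq : IsQuiet D w η ε τ i j) {k : ℕ} (hik : i ≤ k) (hkj : k < j) :
    ‖l (k + 1) - l k‖ ≤ h * (2 * ε) := by
  refine (hs.norm_le k).trans (mul_le_mul_of_nonneg_left ?_ hh)
  obtain ⟨z, hz, hd⟩ := hq.slices k ⟨hik, hkj.le⟩ (k + 1) ⟨by omega, hkj⟩ _ (hs.mem_closure k)
  refine (infDist_le_dist_of_mem hz).trans ?_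
  have h1 := hq.osc (k + 1) ⟨by omega, hkj⟩ k ⟨hik, hkj.le⟩
  calc dist (x k + (w (τ (k + 1)) - w (τ k))) z
      ≤ dist (x k + (w (τ (k + 1)) - w (τ k))) (x k) + dist (x k) z := dist_triangle _ _ _
    _ ≤ ε + ε := add_le_add (by simpa [dist_eq_norm] using h1) hd
    _ = 2 * ε := by ring

/-- As long as the scheme stays near a boundary point `x m`, all reflections share a direction. -/
theorem mul_seqVariation_le {ρ : ℝ} (hs : IsScheme D Γ w h τ x l)
    (hΓ : ∀ t ∈ Icc 0 T, ∀ z ∈ bdry D t, IsClosedConvexCone (Γ t z)) (hτ : ∀ k, τ k ∈ Icc 0 T)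
    {α : ℝ} {u : Euc d} {m : ℕ} (hu : ‖u‖ = 1)
    (hα : ∀ t ∈ Icc (τ m) (τ m + η), ∀ y ∈ bdry D t ∩ closedBall (x m) ρ,
      ∀ γ ∈ unitVectors Γ t y, α ≤ inner ℝ γ u)
    (ht : ∀ k, m ≤ k → k ≤ j → τ k ∈ Icc (τ m) (τ m + η))
    (hball : ∀ k, m ≤ k → k ≤ j → x k ∈ closedBall (x m) ρ) (him : m ≤ i + 1) (hij : i ≤ j) :
    α * seqVariation l i j ≤ ‖l j - l i‖ := by
  have h1 : α * seqVariation l i j ≤ inner ℝ (l j - l i) u := by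
    rw [← Finset.sum_Ico_sub l hij, sum_inner, seqVariation, Finset.mul_sum]
    refine Finset.sum_le_sum fun k hk => ?_
    rw [Finset.mem_Ico] at hk
    by_cases hkl : l (k + 1) = l k
    · simp [hkl]
    obtain ⟨γ, hγ, hΔ⟩ := hs.exists_unitVector hΓ hτ hkl
    have h2 := hα _ (ht (k + 1) (by omega) (by omega)) _
      ⟨(hs.reflection k hkl).1, hball (k + 1) (by omega) (by omega)⟩ γ hγ
    conv_rhs => rw [hΔ]
    rw [real_inner_smul_left, mul_comm]
    exact mul_le_mul_of_nonneg_left h2 (norm_nonneg _)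
  exact h1.trans ((real_inner_le_norm _ _).trans (by rw [hu, mul_one]))

/-- The central estimate for the scheme while it stays near a boundary point `x m`. -/
theorem seqVariation_le_of_mem_closedBall {a e ρ : ℝ} (hs : IsScheme D Γ w h τ x l)
    (hΓ : ∀ t ∈ Icc 0 T, ∀ z ∈ bdry D t, IsClosedConvexCone (Γ t z)) (hτ : ∀ k, τ k ∈ Icc 0 T)
    (hint : UniformInteraction T D Γ ρ η a e) (ha : 0 < a) (he : e < 1) (hε : 0 ≤ ε) (hερ : ε ≤ ρ)
    {m : ℕ} (hm : x m ∈ bdry D (τ m)) (hmj : m ≤ j) (hq : IsQuiet D w η ε τ m j)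
    (hball : ∀ k, m ≤ k → k ≤ j → x k ∈ closedBall (x m) ρ) :
    seqVariation l m j ≤ 8 / (a ^ 2 * (1 - e)) * ε := by
  obtain ⟨α, c, u, haα, hc0, hc1, hce, hu, H⟩ := hint _ (hτ m) _ hm
  have ht : ∀ k, m ≤ k → k ≤ j → τ k ∈ Icc (τ m) (τ m + η) :=
    fun k h1 h2 => hq.time m k le_rfl h1 h2
  have hvar : ∀ n, seqVariation l m (m + n) =
      ∑ k ∈ Finset.range n, ‖(l (m + (k + 1)) - l m) - (l (m + k) - l m)‖ := fun n => by
    rw [seqVariation, Finset.sum_Ico_eq_sum_range]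
    simp [add_assoc]
  obtain ⟨n, rfl⟩ := Nat.exists_eq_add_of_le hmj
  have key : α ^ 2 * (1 - e) * seqVariation l m (m + n) ≤ 2 * (4 * ε) := by
    rw [hvar]
    refine sum_norm_sub_le_of_energy (v := fun k => l (m + k) - l m) (c := c) (by simp)
      (ha.trans_le haα) (by positivity) hc0 hc1 he hce ?_ ?_
    · intro k hk
      simp only [sub_sub_sub_cancel_right, ← add_assoc]
      by_cases hkl : l (m + k + 1) = l (m + k)
      · simp [hkl]
      obtain ⟨γ, hγ, hΔ⟩ := hs.exists_unitVector hΓ hτ hkl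
      have hmem : m + k + 1 ∈ Icc m (m + n) := ⟨by omega, by omega⟩
      obtain ⟨z, hz, hzd⟩ := hq.slices m ⟨le_rfl, hmj⟩ _ hmem _ (hs.mem_closure m)
      have h1 := (H _ (ht _ hmem.1 hmem.2) _
        ⟨(hs.reflection _ hkl).1, hball _ hmem.1 hmem.2⟩ γ hγ).2 z
        ⟨subset_closure hz, by rw [mem_closedBall, dist_comm]; exact hzd.trans hερ⟩
      have hγ1 := norm_of_mem_unitVectors hγ
      have hw := hq.osc _ hmem m ⟨le_rfl, hmj⟩
      rw [dist_eq_norm] at hzd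
      have h2 := (abs_le.1 (abs_inner_le_of_norm_eq_one (v := x m - z) hγ1)).1
      have h3 := (abs_le.1 (abs_inner_le_of_norm_eq_one (v := w (τ (m + k + 1)) - w (τ m)) hγ1)).1
      have hdec : l (m + k + 1) - l m = (x (m + k + 1) - z) - (x m - z) -
          (w (τ (m + k + 1)) - w (τ m)) := by
        rw [hs.decomposition (m + k + 1), hs.decomposition m]; abel
      have h4 : ‖x (m + k + 1) - z‖ ≤ ‖l (m + k + 1) - l m‖ + 2 * ε := by
        have : x (m + k + 1) - z = (l (m + k + 1) - l m) + (x m - z) +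
          (w (τ (m + k + 1)) - w (τ m)) := by rw [hdec]; abel
        rw [this]
        refine (norm_add₃_le).trans ?_
        linarith
      have h5 : inner ℝ γ (l (m + k + 1) - l m) ≤ c * ‖l (m + k + 1) - l m‖ + 4 * ε := by
        rw [hdec, inner_sub_right, inner_sub_right, ← hdec]
        have : c * ‖x (m + k + 1) - z‖ ≤ c * (‖l (m + k + 1) - l m‖ + 2 * ε) := by gcongr
        nlinarith
      calc inner ℝ (l (m + k + 1) - l m) (l (m + k + 1) - l (m + k))
          = ‖l (m + k + 1) - l (m + k)‖ * inner ℝ γ (l (m + k + 1) - l m) := by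
            conv_lhs => rw [hΔ]
            rw [real_inner_smul_right, real_inner_comm]
        _ ≤ _ := by rw [mul_comm]; gcongr
    · intro k hk
      rw [← hvar]
      exact hs.mul_seqVariation_le hΓ hτ hu (fun t ht y hy γ hγ => (H t ht y hy γ hγ).1)
        (fun k' h1 h2 => ht k' h1 (by omega)) (fun k' h1 h2 => hball k' h1 (by omega))
        (by omega) (by omega)
  have h1e : 0 < 1 - e := by linarith
  rw [div_mul_eq_mul_div, le_div_iff₀ (by positivity)]
  have h2 : a ^ 2 * (1 - e) * seqVariation l m (m + n) ≤
      α ^ 2 * (1 - e) * seqVariation l m (m + n) := by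
    have := seqVariation_nonneg l m (m + n)
    gcongr
  linarith

/-- On a quiet range of indices the reflection moves little, and its variation is comparable to
its increment. The range may start away from the boundary: only the part after the first
reflection matters. -/
theorem seqVariation_le {a e ρ : ℝ} (hs : IsScheme D Γ w h τ x l)
    (hΓ : ∀ t ∈ Icc 0 T, ∀ z ∈ bdry D t, IsClosedConvexCone (Γ t z)) (hτ : ∀ k, τ k ∈ Icc 0 T)
    (hint : UniformInteraction T D Γ ρ η a e) (ha : 0 < a) (he : e < 1) (hε : 0 ≤ ε) (hh : 0 ≤ h)
    (hερ : (8 / (a ^ 2 * (1 - e)) + 2 + 2 * h) * ε ≤ ρ)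
    (hq : IsQuiet D w η ε τ i j) :
    a * seqVariation l i j ≤ ‖l j - l i‖ ∧
      seqVariation l i j ≤ (8 / (a ^ 2 * (1 - e)) + 2 * h) * ε := by
  set C := 8 / (a ^ 2 * (1 - e)) with hC
  have h1e : 0 < 1 - e := by linarith
  have hC0 : 0 ≤ C := by positivity
  by_cases hex : ∃ k, i ≤ k ∧ k < j ∧ l (k + 1) ≠ l k
  · classical
    obtain ⟨hik, hkj, hk⟩ := Nat.find_spec hex
    have hmin := fun k => Nat.find_min hex (m := k)
    generalize Nat.find hex = k₀ at hik hkj hk hmin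
    have hzero : seqVariation l i k₀ = 0 := by
      refine Finset.sum_eq_zero fun k hk' => ?_
      rw [Finset.mem_Ico] at hk'
      have := hmin k hk'.2
      rw [not_and, not_and, not_not] at this
      rw [this hk'.1 (by omega), sub_self, norm_zero]
    have hl : l k₀ = l i := by
      have := norm_sub_le_seqVariation l hik
      rw [hzero] at this
      exact sub_eq_zero.1 (norm_le_zero_iff.1 this)
    have hvar : seqVariation l i j = seqVariation l k₀ j := by
      rw [← seqVariation_add l hik hkj.le, hzero, zero_add]
    have hm := (hs.reflection k₀ hk).1
    have hερ' : ε ≤ ρ := by nlinarith [mul_nonneg hC0 hε, mul_nonneg hh hε]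
    have hqm := hq.mono (i' := k₀ + 1) (by omega) le_rfl
    -- the estimate up to `j'` keeps the scheme in the ball for one more step
    have hball : ∀ j', k₀ + 1 ≤ j' → j' ≤ j →
        ∀ k, k₀ + 1 ≤ k → k ≤ j' → x k ∈ closedBall (x (k₀ + 1)) ρ := by
      intro j' hj'
      induction j', hj' using Nat.le_induction with
      | base =>
        intro _ k h1 h2
        obtain rfl : k = k₀ + 1 := by omega
        exact mem_closedBall_self (hε.trans hερ')
      | succ j' hj' ih =>
        intro hj'j k h1 h2
        rcases h2.lt_or_eq with h2 | rfl
        · exact ih (by omega) k h1 (by omega)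
        have hb := ih (by omega)
        have h3 := hs.seqVariation_le_of_mem_closedBall hΓ hτ hint ha he hε hερ' hm hj'
          (hqm.mono le_rfl (by omega)) hb
        have h4 := norm_sub_le_seqVariation l hj'
        have h5 := hs.norm_step_le hh hq (k := j') (by omega) (by omega)
        have h6 := hq.osc (j' + 1) ⟨by omega, by omega⟩ (k₀ + 1) ⟨by omega, by omega⟩
        rw [mem_closedBall, dist_eq_norm]
        have : x (j' + 1) - x (k₀ + 1) = (w (τ (j' + 1)) - w (τ (k₀ + 1))) +
            (l (j' + 1) - l j') + (l j' - l (k₀ + 1)) := by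
          rw [hs.decomposition (j' + 1), hs.decomposition (k₀ + 1)]; abel
        rw [this]
        refine (norm_add₃_le).trans ?_
        nlinarith
    constructor
    · obtain ⟨α, c, u, haα, -, -, -, hu, H⟩ := hint _ (hτ (k₀ + 1)) _ hm
      have := hs.mul_seqVariation_le (i := k₀) (j := j) hΓ hτ hu
        (fun t ht y hy γ hγ => (H t ht y hy γ hγ).1)
        (fun k h1 h2 => hqm.time _ k le_rfl h1 h2) (hball j hkj le_rfl) le_rfl hkj.le
      rw [hvar, ← hl]
      exact (mul_le_mul_of_nonneg_right haα (seqVariation_nonneg _ _ _)).trans this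
    · have h3 := hs.seqVariation_le_of_mem_closedBall hΓ hτ hint ha he hε hερ' hm hkj hqm
        (hball j hkj le_rfl)
      have h5 := hs.norm_step_le hh hq hik hkj
      rw [hvar, ← seqVariation_add l (Nat.le_succ k₀) hkj, Nat.succ_eq_add_one, seqVariation_succ]
      linarith
  · have hzero : seqVariation l i j = 0 := by
      refine Finset.sum_eq_zero fun k hk => ?_
      rw [Finset.mem_Ico] at hk
      have : l (k + 1) = l k := by
        by_contra hne
        exact hex ⟨k, hk.1, hk.2, hne⟩
      rw [this, sub_self, norm_zero]
    rw [hzero, mul_zero]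
    exact ⟨norm_nonneg _, by positivity⟩

/-- If all reflection directions are close to a closed convex cone, so is their sum, relative to
the variation. -/
theorem infDist_sub_le (hs : IsScheme D Γ w h τ x l)
    (hΓ : ∀ t ∈ Icc 0 T, ∀ z ∈ bdry D t, IsClosedConvexCone (Γ t z)) (hτ : ∀ k, τ k ∈ Icc 0 T)
    {K : Set (Euc d)} (hK : IsClosedConvexCone K) {κ : ℝ}
    (hij : i ≤ j) (hκ : ∀ k, i ≤ k → k < j → l (k + 1) ≠ l k →
      ∀ γ ∈ unitVectors Γ (τ (k + 1)) (x (k + 1)), ∃ p ∈ K, ‖γ - p‖ ≤ κ) :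
    ∃ p ∈ K, ‖l j - l i - p‖ ≤ κ * seqVariation l i j := by
  induction j, hij using Nat.le_induction with
  | base => exact ⟨0, hK.zero_mem, by simp [seqVariation]⟩
  | succ j hij ih =>
    obtain ⟨p, hp, hpn⟩ := ih fun k h1 h2 => hκ k h1 (by omega)
    rw [← seqVariation_add l hij (Nat.le_succ j), Nat.succ_eq_add_one, seqVariation_succ]
    by_cases hkl : l (j + 1) = l j
    · exact ⟨p, hp, by simpa [hkl] using hpn⟩
    obtain ⟨γ, hγ, hΔ⟩ := hs.exists_unitVector hΓ hτ hkl
    obtain ⟨q, hqK, hqn⟩ := hκ j hij (by omega) hkl γ hγ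
    refine ⟨p + ‖l (j + 1) - l j‖ • q, hK.add_mem hp (hK.smul_mem (norm_nonneg _) hqK), ?_⟩
    have : l (j + 1) - l i - (p + ‖l (j + 1) - l j‖ • q) =
        (l j - l i - p) + ‖l (j + 1) - l j‖ • (γ - q) := by
      rw [smul_sub, ← hΔ]; abel
    rw [this, mul_add]
    refine (norm_add_le _ _).trans (add_le_add hpn ?_)
    rw [norm_smul, norm_norm, mul_comm κ]
    gcongr

end IsScheme

end Scheme

/-! ### Partitions adapted to a càdlàg function -/

/-- The partition `P` of `[0,T]` resolves `w` up to oscillation `ε` and has mesh at most `r`. The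
condition is stated without reference to consecutive points, so that it passes to refinements. -/
def IsAdapted (T : ℝ) (w : ℝ → Euc d) (ε r : ℝ) (P : Finset ℝ) : Prop :=
  ∀ u ∈ Icc 0 T, ∀ v ∈ Icc 0 T, u ≤ v → (∀ p ∈ P, p ∉ Ioc u v) → ‖w v - w u‖ ≤ ε ∧ v - u ≤ r

section Partition

variable {T ε r : ℝ} {w : ℝ → Euc d}

theorem IsAdapted.mono {P Q : Finset ℝ} (hP : IsAdapted T w ε r P) (hPQ : P ⊆ Q) :
    IsAdapted T w ε r Q :=
  fun u hu v hv huv h => hP u hu v hv huv fun p hp => h p (hPQ hp)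

theorem IsCadlag.exists_right (hw : IsCadlag T w) (hε : 0 < ε) {s : ℝ} (hs : s ∈ Icc 0 T) :
    ∃ δ > 0, ∀ y ∈ Icc 0 T, s ≤ y → y < s + δ → ‖w y - w s‖ ≤ ε := by
  rcases hs.2.lt_or_eq with hsT | rfl
  · have h := (hw.right_continuous s ⟨hs.1, hsT⟩)
    rw [continuousWithinAt_Ioi_iff_Ici, Metric.continuousWithinAt_iff] at h
    obtain ⟨δ, hδ, h⟩ := h ε hε
    refine ⟨δ, hδ, fun y _ hsy hy => ?_⟩
    have := h (x := y) hsy (by rw [Real.dist_eq, abs_lt]; constructor <;> linarith)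
    rw [dist_eq_norm] at this
    exact this.le
  · refine ⟨1, one_pos, fun y hy hsy _ => ?_⟩
    rw [le_antisymm hy.2 hsy, sub_self, norm_zero]
    exact hε.le

theorem IsCadlag.exists_left (hw : IsCadlag T w) (hε : 0 < ε) {s : ℝ} (hs : s ∈ Icc 0 T) :
    ∃ δ > 0, ∃ l, ∀ y ∈ Icc 0 T, y < s → s - δ < y → ‖w y - l‖ ≤ ε := by
  rcases hs.1.lt_or_eq with h0s | rfl
  · obtain ⟨l, hl⟩ := hw.left_limit s ⟨h0s, hs.2⟩
    rw [Metric.tendsto_nhdsWithin_nhds] at hl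
    obtain ⟨δ, hδ, h⟩ := hl ε hε
    refine ⟨δ, hδ, l, fun y _ hys hy => ?_⟩
    have := h (x := y) hys (by rw [Real.dist_eq, abs_lt]; constructor <;> linarith)
    rw [dist_eq_norm] at this
    exact this.le
  · exact ⟨1, one_pos, 0, fun y hy hys _ => absurd hys hy.1.not_gt⟩

theorem IsCadlag.exists_isAdapted (hw : IsCadlag T w) (hε : 0 < ε) (hr : 0 < r) :
    ∃ P : Finset ℝ, IsAdapted T w ε r P := by
  classical
  suffices h : ∃ P : Finset ℝ, ∀ u ∈ Icc 0 T ∩ Icc 0 T, ∀ v ∈ Icc 0 T, u ≤ v →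
      (∀ p ∈ P, p ∉ Ioc u v) → ‖w v - w u‖ ≤ ε ∧ v - u ≤ r by
    obtain ⟨P, hP⟩ := h
    exact ⟨P, fun u hu => hP u ⟨hu, hu⟩⟩
  refine isCompact_Icc.induction_on (p := fun S : Set ℝ => ∃ P : Finset ℝ, ∀ u ∈ S ∩ Icc 0 T,
      ∀ v ∈ Icc 0 T, u ≤ v → (∀ p ∈ P, p ∉ Ioc u v) → ‖w v - w u‖ ≤ ε ∧ v - u ≤ r)
    ⟨∅, by simp⟩ ?_ ?_ ?_
  · rintro S S' hSS' ⟨P, hP⟩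
    exact ⟨P, fun u hu => hP u ⟨hSS' hu.1, hu.2⟩⟩
  · rintro S S' ⟨P, hP⟩ ⟨P', hP'⟩
    refine ⟨P ∪ P', fun u hu v hv huv h => ?_⟩
    rcases hu.1 with h1 | h1
    · exact hP u ⟨h1, hu.2⟩ v hv huv fun p hp => h p (Finset.mem_union_left _ hp)
    · exact hP' u ⟨h1, hu.2⟩ v hv huv fun p hp => h p (Finset.mem_union_right _ hp)
  · intro s hs
    obtain ⟨δ₁, hδ₁, h₁⟩ := hw.exists_right (half_pos hε) hs
    obtain ⟨δ₂, hδ₂, l, h₂⟩ := hw.exists_left (half_pos hε) hs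
    have hm : 0 < min (min δ₁ δ₂) (r / 2) := lt_min (lt_min hδ₁ hδ₂) (half_pos hr)
    have hm1 : min (min δ₁ δ₂) (r / 2) ≤ δ₁ := (min_le_left _ _).trans (min_le_left _ _)
    have hm2 : min (min δ₁ δ₂) (r / 2) ≤ δ₂ := (min_le_left _ _).trans (min_le_right _ _)
    have hm3 : min (min δ₁ δ₂) (r / 2) ≤ r / 2 := min_le_right _ _
    generalize min (min δ₁ δ₂) (r / 2) = δ at hm hm1 hm2 hm3
    refine ⟨Ioo (s - δ) (s + δ), mem_nhdsWithin_of_mem_nhds (Ioo_mem_nhds (by linarith)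
      (by linarith)), {s, s + δ}, fun u hu v hv huv h => ?_⟩
    obtain ⟨⟨hu1, hu2⟩, huT⟩ := hu
    have hvδ : v < s + δ := by
      by_contra! hcon
      exact h (s + δ) (by simp) ⟨hu2, hcon⟩
    refine ⟨?_, by linarith⟩
    have key : ∀ l' : Euc d, ‖w v - l'‖ ≤ ε / 2 → ‖w u - l'‖ ≤ ε / 2 → ‖w v - w u‖ ≤ ε := by
      intro l' hv' hu'
      have : w v - w u = (w v - l') - (w u - l') := by abel
      rw [this]
      exact (norm_sub_le _ _).trans (by linarith)
    rcases le_or_gt s u with hsu | hus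
    · exact key (w s) (h₁ v hv (hsu.trans huv) (by linarith)) (h₁ u huT hsu (by linarith))
    · have hvs : v < s := by
        by_contra! hcon
        exact h s (by simp) ⟨hus, hcon⟩
      exact key l (h₂ v hv hvs (by linarith)) (h₂ u huT hus (by linarith))

/-- Between consecutive points of an adapted partition `w` moves by a jump and an oscillation. -/
theorem IsAdapted.norm_sub_le_of_Ioo {P : Finset ℝ} (hP : IsAdapted T w ε r P) (hw : IsCadlag T w)
    {c : ℝ} (hc : ∀ t ∈ Ioc 0 T, ∀ l, Tendsto w (𝓝[<] t) (𝓝 l) → ‖w t - l‖ ≤ c)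
    {u v : ℝ} (hu : 0 ≤ u) (hv : v ≤ T) (huv : u < v) (h : ∀ p ∈ P, p ∉ Ioo u v) :
    ‖w v - w u‖ ≤ c + ε ∧ v - u ≤ r := by
  obtain ⟨l, hl⟩ := hw.left_limit v ⟨hu.trans_lt huv, hv⟩
  have hev : ∀ᶠ y in 𝓝[<] v, ‖w y - w u‖ ≤ ε ∧ y - u ≤ r := by
    filter_upwards [Ioo_mem_nhdsLT huv] with y hy
    exact hP u ⟨hu, by linarith⟩ y ⟨by linarith [hy.1], by linarith [hy.2]⟩ hy.1.le
      fun p hp hpu => h p hp ⟨hpu.1, hpu.2.trans_lt hy.2⟩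
  have h1 : ‖l - w u‖ ≤ ε := le_of_tendsto (hl.sub_const _).norm (hev.mono fun y hy => hy.1)
  have hid : Tendsto (fun y : ℝ => y - u) (𝓝[<] v) (𝓝 (v - u)) :=
    ((continuous_id.sub continuous_const).tendsto v).mono_left nhdsWithin_le_nhds
  refine ⟨?_, le_of_tendsto hid (hev.mono fun y hy => hy.2)⟩
  have h2 := hc v ⟨hu.trans_lt huv, hv⟩ l hl
  have : w v - w u = (w v - l) + (l - w u) := by abel
  rw [this]
  exact (norm_add_le _ _).trans (add_le_add h2 h1)

end Partition

/-- The time sections at times within `r` of each other are within `ε` of each other. -/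
def SlicesClose (T : ℝ) (D : Set (ℝ × Euc d)) (r ε : ℝ) : Prop :=
  ∀ s ∈ Icc 0 T, ∀ t ∈ Icc 0 T, |s - t| ≤ r → ∀ z ∈ closure (slice D s),
    ∃ z' ∈ slice D t, dist z z' ≤ ε

theorem exists_slicesClose {T ε : ℝ} {D : Set (ℝ × Euc d)}
    (hl : Tendsto (timeModulus T D) (𝓝[>] 0) (𝓝 0)) (hε : 0 < ε) :
    ∃ r > 0, SlicesClose T D r ε := by
  have h1 : ∀ᶠ r in 𝓝[>] (0 : ℝ), timeModulus T D r < ENNReal.ofReal ε :=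
    hl.eventually (gt_mem_nhds (by simpa using hε))
  obtain ⟨r, hr, hr0⟩ := (h1.and self_mem_nhdsWithin).exists
  refine ⟨r, hr0, fun s hs t ht hst z hz => ?_⟩
  have h2 : infEDist z (slice D t) ≤ timeModulus T D r := by
    unfold timeModulus
    exact le_iSup₂_of_le s hs (le_iSup₂_of_le t ht (le_iSup₂_of_le hst z (le_iSup_of_le hz le_rfl)))
  obtain ⟨z', hz', h3⟩ := infEDist_lt_iff.1 (h2.trans_lt hr)
  refine ⟨z', hz', ?_⟩
  rw [edist_dist, ENNReal.ofReal_lt_ofReal_iff hε] at h3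
  exact h3.le

/-! ### Existence of discrete solutions -/

theorem exists_isScheme {T : ℝ} {D : Set (ℝ × Euc d)} {Γ : ℝ → Euc d → Set (Euc d)}
    {w : ℝ → Euc d} {δ h : ℝ} {τ : ℕ → ℝ} (hh : 0 ≤ h) (hproj : GoodProjections T δ h D Γ)
    (hτ : ∀ k, τ k ∈ Icc 0 T) (hw₀ : w (τ 0) ∈ closure (slice D (τ 0)))
    (hstep : ∀ k, ∀ z ∈ closure (slice D (τ k)),
      infDist (z + (w (τ (k + 1)) - w (τ k))) (slice D (τ (k + 1))) < δ) :
    ∃ x l : ℕ → Euc d, IsScheme D Γ w h τ x l := by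
  have step : ∀ k, ∀ z : {z // z ∈ closure (slice D (τ k))},
      ∃ z' : {z' // z' ∈ closure (slice D (τ (k + 1)))},
        ((z' : Euc d) ≠ (z : Euc d) + (w (τ (k + 1)) - w (τ k)) →
          (z' : Euc d) ∈ bdry D (τ (k + 1)) ∧
          (z' : Euc d) - ((z : Euc d) + (w (τ (k + 1)) - w (τ k))) ∈ Γ (τ (k + 1)) z') ∧
        ‖(z' : Euc d) - ((z : Euc d) + (w (τ (k + 1)) - w (τ k)))‖ ≤
          h * infDist ((z : Euc d) + (w (τ (k + 1)) - w (τ k))) (slice D (τ (k + 1))) := by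
    rintro k ⟨z, hz⟩
    by_cases hy : z + (w (τ (k + 1)) - w (τ k)) ∈ closure (slice D (τ (k + 1)))
    · exact ⟨⟨_, hy⟩, fun h => absurd rfl h, by
        simpa using mul_nonneg hh infDist_nonneg⟩
    · obtain ⟨p, hp, hpΓ, hpn⟩ := hproj _ (hτ (k + 1)) _ hy (hstep k z hz)
      exact ⟨⟨p, frontier_subset_closure hp⟩, fun _ => ⟨hp, hpΓ⟩, by rwa [norm_sub_rev]⟩
  choose f hf using step
  let X : ∀ k, {z // z ∈ closure (slice D (τ k))} := fun k =>
    Nat.rec (motive := fun k => {z // z ∈ closure (slice D (τ k))}) ⟨w (τ 0), hw₀⟩ f k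
  have hX : ∀ k, X (k + 1) = f k (X k) := fun k => rfl
  have hΔ : ∀ k, ((X (k + 1) : Euc d) - w (τ (k + 1))) - ((X k : Euc d) - w (τ k)) =
      (X (k + 1) : Euc d) - ((X k : Euc d) + (w (τ (k + 1)) - w (τ k))) := fun k => by abel
  refine ⟨fun k => X k, fun k => (X k : Euc d) - w (τ k), fun k => by abel, sub_self _,
    fun k => (X k).2, fun k hk => ?_, fun k => ?_⟩
  · rw [hΔ, hX]
    refine (hf k (X k)).1 fun heq => hk ?_
    rw [← sub_eq_zero, hΔ, hX, heq, sub_self]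
  · rw [hΔ, hX]
    exact (hf k (X k)).2

/-- A discrete solution along the increasing enumeration `τ 0 = 0, …, τ N` of a finite set of
times in `[0,T]`. What the sequences do beyond `N` is irrelevant. -/
structure DiscreteSolution (T : ℝ) (D : Set (ℝ × Euc d)) (Γ : ℝ → Euc d → Set (Euc d))
    (w : ℝ → Euc d) (h : ℝ) where
  N : ℕ
  τ : ℕ → ℝ
  x : ℕ → Euc d
  l : ℕ → Euc d
  zero : τ 0 = 0
  monotone : Monotone τ
  strictMonoOn : StrictMonoOn τ (Iic N)
  mem_Icc : ∀ k, τ k ∈ Icc 0 T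
  scheme : IsScheme D Γ w h τ x l

theorem exists_enumeration {T : ℝ} {P : Finset ℝ} (h0 : 0 ∈ P) (hP : ∀ p ∈ P, p ∈ Icc 0 T) :
    ∃ (N : ℕ) (τ : ℕ → ℝ), τ 0 = 0 ∧ Monotone τ ∧ StrictMonoOn τ (Iic N) ∧
      (∀ k, τ k ∈ P) ∧ ∀ p ∈ P, ∃ k ≤ N, τ k = p := by
  have hc : 0 < P.card := Finset.card_pos.2 ⟨0, h0⟩
  set g := P.orderEmbOfFin rfl
  have hk : ∀ k, min k (P.card - 1) < P.card := fun k => by omega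
  have hmem : ∀ i, g i ∈ P := fun i => Finset.orderEmbOfFin_mem P rfl i
  have hsurj : ∀ p ∈ P, ∃ k ≤ P.card - 1, g ⟨min k (P.card - 1), hk k⟩ = p := by
    intro p hp
    have : p ∈ Set.range g := by rw [Finset.range_orderEmbOfFin]; exact hp
    obtain ⟨i, rfl⟩ := this
    refine ⟨i, by omega, congrArg g (Fin.ext ?_)⟩
    simp only
    omega
  have hmono : Monotone fun k => g ⟨min k (P.card - 1), hk k⟩ := by
    intro i j hij
    refine g.monotone ?_
    rw [Fin.mk_le_mk]
    omega
  refine ⟨P.card - 1, fun k => g ⟨min k (P.card - 1), hk k⟩, ?_, hmono, ?_, fun k => hmem _, hsurj⟩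
  · obtain ⟨k, -, hk0⟩ := hsurj 0 h0
    refine le_antisymm ?_ (hP _ (hmem _)).1
    rw [← hk0]
    exact hmono (Nat.zero_le k)
  · intro i hi j hj hij
    refine g.strictMono ?_
    rw [mem_Iic] at hi hj
    rw [Fin.mk_lt_mk]
    omega

/-- Along an adapted partition, the position before the projection stays in the range of the good
projections. -/
theorem exists_discreteSolution {T : ℝ} {D : Set (ℝ × Euc d)} {Γ : ℝ → Euc d → Set (Euc d)}
    {w : ℝ → Euc d} {δ h ε r c : ℝ} {P : Finset ℝ} (hh : 0 ≤ h) (hproj : GoodProjections T δ h D Γ)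
    (hw : IsCadlag T w) (hc : ∀ t ∈ Ioc 0 T, ∀ l, Tendsto w (𝓝[<] t) (𝓝 l) → ‖w t - l‖ ≤ c)
    (hw₀ : w 0 ∈ closure (slice D 0)) (h0 : 0 ∈ P) (hPT : ∀ p ∈ P, p ∈ Icc 0 T)
    (hc0 : 0 ≤ c) (hε : 0 ≤ ε) (hr : 0 ≤ r) (hP : IsAdapted T w ε r P) (hD : SlicesClose T D r ε)
    (hδ : c + 2 * ε < δ) :
    ∃ S : DiscreteSolution T D Γ w h, (∀ k, S.τ k ∈ P) ∧ (∀ p ∈ P, ∃ k ≤ S.N, S.τ k = p) ∧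
      ∀ k, ‖S.l (k + 1) - S.l k‖ ≤ h * (c + 2 * ε) := by
  obtain ⟨N, τ, hτ0, hmono, hstrict, hmem, hsurj⟩ := exists_enumeration h0 hPT
  have hinc : ∀ k, ‖w (τ (k + 1)) - w (τ k)‖ ≤ c + ε ∧ τ (k + 1) - τ k ≤ r := by
    intro k
    rcases (hmono (Nat.le_succ k)).eq_or_lt with heq | hlt
    · rw [← Nat.succ_eq_add_one, ← heq]
      simp only [sub_self, norm_zero]
      exact ⟨by positivity, hr⟩
    · refine hP.norm_sub_le_of_Ioo hw hc (hPT _ (hmem k)).1 (hPT _ (hmem (k + 1))).2 hlt ?_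
      intro p hp hpI
      obtain ⟨j, -, rfl⟩ := hsurj p hp
      have h1 : k < j := by
        by_contra! hcon
        exact hpI.1.not_ge (hmono hcon)
      exact hpI.2.not_ge (hmono h1)
  have hdist : ∀ k, ∀ z ∈ closure (slice D (τ k)),
      infDist (z + (w (τ (k + 1)) - w (τ k))) (slice D (τ (k + 1))) ≤ c + 2 * ε := by
    intro k z hz
    obtain ⟨z', hz', hzz⟩ := hD _ (hPT _ (hmem k)) _ (hPT _ (hmem (k + 1)))
      (by
        rw [abs_sub_comm, abs_of_nonneg (sub_nonneg.2 (hmono (Nat.le_succ k)))]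
        exact (hinc k).2) z hz
    refine (infDist_le_dist_of_mem hz').trans ?_
    calc dist (z + (w (τ (k + 1)) - w (τ k))) z'
        ≤ dist (z + (w (τ (k + 1)) - w (τ k))) z + dist z z' := dist_triangle _ _ _
      _ ≤ (c + ε) + ε := add_le_add (by simpa [dist_eq_norm] using (hinc k).1) hzz
      _ = c + 2 * ε := by ring
  obtain ⟨x, l, hs⟩ := exists_isScheme (τ := τ) hh hproj (fun k => hPT _ (hmem k))
    (by rwa [hτ0]) fun k z hz => (hdist k z hz).trans_lt hδ
  exact ⟨⟨N, τ, x, l, hτ0, hmono, hstrict, fun k => hPT _ (hmem k), hs⟩, hmem, hsurj,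
    fun k => (hs.norm_le k).trans (mul_le_mul_of_nonneg_left (hdist k _ (hs.mem_closure k)) hh)⟩

/-! ### Functions dominated by a monotone function -/

theorem eVariationOn_le_of_norm_sub_le {E : Type*} [SeminormedAddCommGroup E] {f : ℝ → E}
    {G : ℝ → ℝ} {u v : ℝ}
    (h : ∀ s ∈ Icc u v, ∀ t ∈ Icc u v, s ≤ t → ‖f t - f s‖ ≤ G t - G s) :
    eVariationOn f (Icc u v) ≤ ENNReal.ofReal (G v - G u) := by
  refine iSup_le ?_
  rintro ⟨n, t, ht, htm⟩
  have hG : ∀ s ∈ Icc u v, ∀ t ∈ Icc u v, s ≤ t → 0 ≤ G t - G s :=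
    fun s hs t ht hst => (norm_nonneg _).trans (h s hs t ht hst)
  have huv : u ≤ v := (htm 0).1.trans (htm 0).2
  have key : ∀ n, ∑ i ∈ Finset.range n, edist (f (t (i + 1))) (f (t i)) ≤
      ENNReal.ofReal (G (t n) - G (t 0)) := by
    intro n
    induction n with
    | zero => simp
    | succ n ih =>
      have h1 := hG _ (htm 0) _ (htm n) (ht (Nat.zero_le n))
      have h2 := hG _ (htm n) _ (htm (n + 1)) (ht (Nat.le_succ n))
      rw [Finset.sum_range_succ, ← sub_add_sub_cancel', ENNReal.ofReal_add h1 h2]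
      refine add_le_add ih ?_
      rw [edist_dist, dist_eq_norm]
      exact ENNReal.ofReal_le_ofReal (h _ (htm n) _ (htm (n + 1)) (ht (Nat.le_succ n)))
  refine (key n).trans (ENNReal.ofReal_le_ofReal ?_)
  have h1 := hG u ⟨le_rfl, huv⟩ _ (htm 0) (htm 0).1
  have h2 := hG _ (htm n) v ⟨huv, le_rfl⟩ (htm n).2
  linarith

/-! ### Discrete solutions as step functions -/

namespace DiscreteSolution

variable {T : ℝ} {D : Set (ℝ × Euc d)} {Γ : ℝ → Euc d → Set (Euc d)} {w : ℝ → Euc d} {h : ℝ}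
  (S : DiscreteSolution T D Γ w h)

open scoped Classical in
/-- The index of the last time of the scheme up to `t`. -/
def index (t : ℝ) : ℕ := Nat.findGreatest (fun k => S.τ k ≤ t) S.N

/-- The reflection term as a step function of time. -/
def refl (t : ℝ) : Euc d := S.l (S.index t)

/-- The variation of the reflection term over `(u, v]`. -/
def variation (u v : ℝ) : ℝ := seqVariation S.l (S.index u) (S.index v)

variable {S}

theorem index_le (t : ℝ) : S.index t ≤ S.N := Nat.findGreatest_le _

theorem τ_index_le {t : ℝ} (ht : 0 ≤ t) : S.τ (S.index t) ≤ t := by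
  classical
  exact Nat.findGreatest_spec (P := fun k => S.τ k ≤ t) (Nat.zero_le _) (by rwa [S.zero])

theorem le_index_iff {t : ℝ} (ht : 0 ≤ t) {k : ℕ} (hk : k ≤ S.N) : k ≤ S.index t ↔ S.τ k ≤ t := by
  classical
  exact ⟨fun h => (S.monotone h).trans (τ_index_le ht), fun h => Nat.le_findGreatest hk h⟩

theorem index_mono {s t : ℝ} (hs : 0 ≤ s) (hst : s ≤ t) : S.index s ≤ S.index t :=
  (le_index_iff (hs.trans hst) (index_le s)).2 ((τ_index_le hs).trans hst)

theorem index_τ {k : ℕ} (hk : k ≤ S.N) : S.index (S.τ k) = k := by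
  have h0 := (S.mem_Icc k).1
  refine le_antisymm ?_ ((le_index_iff h0 hk).2 le_rfl)
  exact (S.strictMonoOn.le_iff_le (index_le _) hk).1 (τ_index_le h0)

theorem index_lt {t : ℝ} {k : ℕ} (ht : 0 ≤ t) (h : t < S.τ k) : S.index t < k := by
  by_contra! hcon
  exact (h.trans_le (S.monotone hcon)).not_ge (τ_index_le ht)

theorem index_zero : S.index 0 = 0 := by
  have := index_τ (S := S) (Nat.zero_le _)
  rwa [S.zero] at this

theorem refl_zero : S.refl 0 = 0 := by rw [refl, index_zero, S.scheme.zero]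

theorem variation_nonneg (u v : ℝ) : 0 ≤ S.variation u v := seqVariation_nonneg _ _ _

theorem variation_add {u v t : ℝ} (hu : 0 ≤ u) (huv : u ≤ v) (hvt : v ≤ t) :
    S.variation u v + S.variation v t = S.variation u t :=
  seqVariation_add _ (index_mono hu huv) (index_mono (hu.trans huv) hvt)

theorem norm_refl_sub_le {u v : ℝ} (hu : 0 ≤ u) (huv : u ≤ v) :
    ‖S.refl v - S.refl u‖ ≤ S.variation u v :=
  norm_sub_le_seqVariation _ (index_mono hu huv)

theorem eVariationOn_refl_le {u v : ℝ} (hu : 0 ≤ u) :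
    eVariationOn S.refl (Icc u v) ≤ ENNReal.ofReal (S.variation u v) := by
  refine (eVariationOn_le_of_norm_sub_le (G := S.variation u) fun s hs t ht hst => ?_).trans
    (ENNReal.ofReal_le_ofReal (sub_le_self _ (variation_nonneg _ _)))
  rw [← variation_add hu hs.1 hst, add_sub_cancel_left]
  exact norm_refl_sub_le (hu.trans hs.1) hst

/-- Between points of an adapted subset of the times of the scheme, the scheme is quiet. -/
theorem isQuiet {Q : Finset ℝ} {ε r η u v : ℝ} (hQ : ∀ q ∈ Q, ∃ k ≤ S.N, S.τ k = q)
    (hA : IsAdapted T w ε r Q) (hD : SlicesClose T D r ε) (hrη : r ≤ η) (hu : 0 ≤ u) (huv : u ≤ v)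
    (hQuv : ∀ q ∈ Q, q ∉ Ioc u v) :
    IsQuiet D w η ε S.τ (S.index u) (S.index v) := by
  have key : ∀ k k', S.index u ≤ k → k ≤ k' → k' ≤ S.index v →
      ‖w (S.τ k') - w (S.τ k)‖ ≤ ε ∧ S.τ k' - S.τ k ≤ r := by
    intro k k' h1 h2 h3
    refine hA _ (S.mem_Icc k) _ (S.mem_Icc k') (S.monotone h2) fun q hq hqI => ?_
    obtain ⟨j, hj, rfl⟩ := hQ q hq
    have hjv : S.τ j ≤ v := (hqI.2.trans (S.monotone h3)).trans (τ_index_le (hu.trans huv))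
    have hju : S.τ j ≤ u := by
      by_contra! hcon
      exact hQuv _ hq ⟨hcon, hjv⟩
    exact hqI.1.not_ge (S.monotone (((le_index_iff hu hj).2 hju).trans h1))
  refine ⟨fun k k' h1 h2 h3 => ⟨S.monotone h2, ?_⟩, fun k hk k' hk' => ?_, fun k hk k' hk' => ?_⟩
  · have := (key k k' h1 h2 h3).2
    linarith
  · rcases le_total k k' with hkk | hkk
    · rw [norm_sub_rev]; exact (key k k' hk.1 hkk hk'.2).1
    · exact (key k' k hk'.1 hkk hk.2).1
  · refine hD _ (S.mem_Icc k) _ (S.mem_Icc k') ?_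
    rcases le_total k k' with hkk | hkk
    · rw [abs_sub_comm, abs_of_nonneg (sub_nonneg.2 (S.monotone hkk))]
      exact (key k k' hk.1 hkk hk'.2).2
    · rw [abs_of_nonneg (sub_nonneg.2 (S.monotone hkk))]
      exact (key k' k hk'.1 hkk hk.2).2

/-- If `t = τ k` is a time of the scheme and `u < t`, the last step before `t` can be split off:
it ends a range of indices which belongs to an interval `(u, u']` with `u' < t`. -/
theorem exists_index_eq_pred {u : ℝ} {k : ℕ} (hk : k ≤ S.N) (hu : 0 ≤ u) (hut : u < S.τ k) :
    1 ≤ k ∧ ∃ u', u ≤ u' ∧ u' < S.τ k ∧ S.index u' = k - 1 := by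
  have hk1 : 1 ≤ k := (Nat.zero_le _).trans_lt (index_lt hu hut)
  refine ⟨hk1, max u (S.τ (k - 1)), le_max_left _ _, max_lt hut ?_, ?_⟩
  · exact S.strictMonoOn (show k - 1 ≤ S.N by omega) hk (by omega)
  · have h0 : 0 ≤ max u (S.τ (k - 1)) := hu.trans (le_max_left _ _)
    have h1 : S.index (max u (S.τ (k - 1))) < k := index_lt h0 (max_lt hut
      (S.strictMonoOn (show k - 1 ≤ S.N by omega) hk (by omega)))
    have h2 := (le_index_iff (S := S) h0 (k := k - 1) (by omega)).2 (le_max_right _ _)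
    omega

/-- The variation over an interval whose interior contains no point of `Q` is at most a local
oscillation and one jump. -/
theorem variation_le_of_Ioo {Q : Finset ℝ} {b b' : ℝ} (hQ : ∀ q ∈ Q, ∃ k ≤ S.N, S.τ k = q)
    (hb' : ∀ k, ‖S.l (k + 1) - S.l k‖ ≤ b')
    (hb : ∀ u v, 0 ≤ u → u ≤ v → v ≤ T → (∀ q ∈ Q, q ∉ Ioc u v) → S.variation u v ≤ b)
    {u t : ℝ} (hu : 0 ≤ u) (hut : u ≤ t) (ht : t ≤ T) (h : ∀ q ∈ Q, q ∉ Ioo u t) :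
    S.variation u t ≤ b + b' := by
  have hb'0 : 0 ≤ b' := (norm_nonneg _).trans (hb' 0)
  by_cases htQ : t ∈ Q ∧ u < t
  · obtain ⟨k, hk, rfl⟩ := hQ t htQ.1
    obtain ⟨hk1, u', huu', hu't, hidx⟩ := exists_index_eq_pred hk hu htQ.2
    have h1 := hb u u' hu huu' (hu't.le.trans ht)
      fun q hq hqI => h q hq ⟨hqI.1, hqI.2.trans_lt hu't⟩
    rw [← variation_add hu huu' hu't.le]
    refine add_le_add h1 ?_
    obtain ⟨j, rfl⟩ := Nat.exists_eq_add_of_le' hk1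
    rw [variation, hidx, index_τ hk, Nat.add_sub_cancel, seqVariation_succ]
    exact hb' j
  · refine (hb u t hu hut ht fun q hq hqI => ?_).trans (by linarith)
    rcases hqI.2.lt_or_eq with hlt | rfl
    · exact h q hq ⟨hqI.1, hlt⟩
    · exact htQ ⟨hq, hqI.1⟩

theorem variation_le_card {Q : Finset ℝ} {b : ℝ} (hb0 : 0 ≤ b)
    (hb : ∀ u v, 0 ≤ u → u ≤ v → v ≤ T → (∀ q ∈ Q, q ∉ Ioo u v) → S.variation u v ≤ b)
    {u v : ℝ} (hu : 0 ≤ u) (huv : u ≤ v) (hv : v ≤ T) :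
    S.variation u v ≤ (Q.card + 1) * b := by
  classical
  have key : ∀ n : ℕ, ∀ u v : ℝ, 0 ≤ u → u ≤ v → v ≤ T →
      (Q.filter fun q => q ∈ Ioo u v).card ≤ n → S.variation u v ≤ (n + 1) * b := by
    intro n
    induction n using Nat.strong_induction_on with
    | _ n ih =>
      intro u v hu huv hv hn
      by_cases hex : ∃ q ∈ Q, q ∈ Ioo u v
      · obtain ⟨q, hq, hqI⟩ := hex
        have hdisj : Disjoint (Q.filter fun p => p ∈ Ioo u q) (Q.filter fun p => p ∈ Ioo q v) := by
          rw [Finset.disjoint_left]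
          intro p hp hp'
          rw [Finset.mem_filter] at hp hp'
          exact hp.2.2.not_gt hp'.2.1
        have hqn : q ∉ (Q.filter fun p => p ∈ Ioo u q) ∪ (Q.filter fun p => p ∈ Ioo q v) := by
          simp
        have hsub : insert q ((Q.filter fun p => p ∈ Ioo u q) ∪ (Q.filter fun p => p ∈ Ioo q v)) ⊆
            Q.filter fun p => p ∈ Ioo u v := by
          intro p hp
          rw [Finset.mem_insert, Finset.mem_union, Finset.mem_filter, Finset.mem_filter] at hp
          rw [Finset.mem_filter]
          rcases hp with rfl | hp | hp
          · exact ⟨hq, hqI⟩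
          · exact ⟨hp.1, hp.2.1, hp.2.2.trans hqI.2⟩
          · exact ⟨hp.1, hqI.1.trans hp.2.1, hp.2.2⟩
        have hcard := Finset.card_le_card hsub
        rw [Finset.card_insert_of_notMem hqn, Finset.card_union_of_disjoint hdisj] at hcard
        set n₁ := (Q.filter fun p => p ∈ Ioo u q).card
        set n₂ := (Q.filter fun p => p ∈ Ioo q v).card
        have h1 := ih n₁ (by omega) u q hu hqI.1.le (hqI.2.le.trans hv) le_rfl
        have h2 := ih n₂ (by omega) q v (hu.trans hqI.1.le) hqI.2.le hv le_rfl
        rw [← variation_add hu hqI.1.le hqI.2.le]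
        have h3 : (n₁ : ℝ) + n₂ + 1 ≤ n := by exact_mod_cast hcard.trans hn
        nlinarith
      · refine (hb u v hu huv hv fun q hq hqI => hex ⟨q, hq, hqI⟩).trans ?_
        nlinarith [n.cast_nonneg (α := ℝ)]
  exact key _ u v hu huv hv (Finset.card_filter_le _ _)

end DiscreteSolution

/-! ### Approximating sequences -/

/-- A sequence of discrete solutions along increasing partitions `P n`, with estimates that are
uniform in `n`. The variation is small, uniformly in `n ≥ m`, away from the points of `P m`;
it is comparable to the increments, with constant `a`, away from the points of `P 0`; and it is at
most `b` between the points of `P 0`. -/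
structure IsApproximation {T : ℝ} {D : Set (ℝ × Euc d)} {Γ : ℝ → Euc d → Set (Euc d)}
    {w : ℝ → Euc d} {h : ℝ} (a b : ℝ) (P : ℕ → Finset ℝ) (S : ℕ → DiscreteSolution T D Γ w h) :
    Prop where
  monotone : Monotone P
  zero_mem : 0 ∈ P 0
  right_mem : T ∈ P 0
  mem_iff : ∀ n p, p ∈ P n ↔ ∃ k ≤ (S n).N, (S n).τ k = p
  adapted : ∀ ε > 0, ∃ m, IsAdapted T w ε ε (P m)
  small : ∀ ε > 0, ∃ m, ∀ n ≥ m, ∀ u v, 0 ≤ u → u ≤ v → v ≤ T → (∀ q ∈ P m, q ∉ Ioc u v) →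
    (S n).variation u v ≤ ε
  comparable : ∀ n u v, 0 ≤ u → u ≤ v → v ≤ T → (∀ q ∈ P 0, q ∉ Ioc u v) →
    a * (S n).variation u v ≤ ‖(S n).refl v - (S n).refl u‖
  jump : ∀ n u v, 0 ≤ u → u ≤ v → v ≤ T → (∀ q ∈ P 0, q ∉ Ioo u v) → (S n).variation u v ≤ b

theorem exists_isApproximation {T : ℝ} {D : Set (ℝ × Euc d)} {Γ : ℝ → Euc d → Set (Euc d)}
    {w : ℝ → Euc d} {a e ρ η δ h c : ℝ} (hT : 0 < T)
    (hl : Tendsto (timeModulus T D) (𝓝[>] 0) (𝓝 0))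
    (hΓ : ∀ t ∈ Icc 0 T, ∀ z ∈ bdry D t, IsClosedConvexCone (Γ t z))
    (hρ : 0 < ρ) (hη : 0 < η) (hint : UniformInteraction T D Γ ρ η a e) (ha : 0 < a) (he : e < 1)
    (hh : 0 < h) (hproj : GoodProjections T δ h D Γ) (hw : IsCadlag T w) (hc0 : 0 ≤ c)
    (hc : ∀ t ∈ Ioc 0 T, ∀ l, Tendsto w (𝓝[<] t) (𝓝 l) → ‖w t - l‖ ≤ c)
    (hcδ : c < δ) (hcρ : c < ρ / (4 * h)) (hw₀ : w 0 ∈ closure (slice D 0)) :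
    ∃ (P : ℕ → Finset ℝ) (S : ℕ → DiscreteSolution T D Γ w h), IsApproximation a (ρ / 2) P S := by
  classical
  set C := 8 / (a ^ 2 * (1 - e)) with hC
  have h1e : 0 < 1 - e := by linarith
  have hC0 : 0 ≤ C := by positivity
  -- one step of the scheme and the oscillation on a quiet range are both at most `ρ / 4`
  obtain ⟨ε₀, hε₀, hε₁, hε₂, hε₃⟩ : ∃ ε₀ > 0, (C + 2 + 2 * h) * ε₀ ≤ ρ / 4 ∧ c + 2 * ε₀ < δ ∧
      h * (c + 2 * ε₀) ≤ ρ / 4 := by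
    have hA : 0 < C + 2 + 2 * h := by positivity
    have h1 : 0 < ρ / 4 / (C + 2 + 2 * h) := by positivity
    have h2 : 0 < (δ - c) / 4 := by linarith
    have h3 : 0 < (ρ / (4 * h) - c) / 2 := by linarith
    refine ⟨min (min (ρ / 4 / (C + 2 + 2 * h)) ((δ - c) / 4)) ((ρ / (4 * h) - c) / 2),
      lt_min (lt_min h1 h2) h3, ?_, ?_, ?_⟩
    · rw [mul_comm, ← le_div_iff₀ hA]
      exact (min_le_left _ _).trans (min_le_left _ _)
    · have : min (min (ρ / 4 / (C + 2 + 2 * h)) ((δ - c) / 4)) ((ρ / (4 * h) - c) / 2) ≤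
          (δ - c) / 4 := (min_le_left _ _).trans (min_le_right _ _)
      linarith
    · have h4 : min (min (ρ / 4 / (C + 2 + 2 * h)) ((δ - c) / 4)) ((ρ / (4 * h) - c) / 2) ≤
          (ρ / (4 * h) - c) / 2 := min_le_right _ _
      calc h * (c + 2 * min (min (ρ / 4 / (C + 2 + 2 * h)) ((δ - c) / 4)) ((ρ / (4 * h) - c) / 2))
          ≤ h * (ρ / (4 * h)) := by gcongr; linarith
        _ = ρ / 4 := by field_simp
  set ε : ℕ → ℝ := fun n => ε₀ / (n + 1) with hε
  have hε0 : ∀ n, 0 < ε n := fun n => by positivity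
  have hεle : ∀ n, ε n ≤ ε₀ := fun n => by
    refine div_le_self hε₀.le ?_
    have : (0 : ℝ) ≤ n := n.cast_nonneg
    linarith
  have hεlim : ∀ ε' > 0, ∃ n, ε n ≤ ε' := by
    intro ε' hε'
    obtain ⟨n, hn⟩ := exists_nat_ge (ε₀ / ε')
    refine ⟨n, ?_⟩
    rw [div_le_iff₀ hε'] at hn
    rw [hε, div_le_iff₀ (by positivity)]
    nlinarith
  have hr : ∀ n, ∃ r > 0, r ≤ η ∧ r ≤ ε n ∧ SlicesClose T D r (ε n) := by
    intro n
    obtain ⟨r, hr, hD⟩ := exists_slicesClose hl (hε0 n)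
    exact ⟨min r (min η (ε n)), lt_min hr (lt_min hη (hε0 n)), (min_le_right _ _).trans
      (min_le_left _ _), (min_le_right _ _).trans (min_le_right _ _),
      fun s hs t ht hst => hD s hs t ht (hst.trans (min_le_left _ _))⟩
  choose r hr0 hrη hrε hrD using hr
  have hQ : ∀ n, ∃ Q : Finset ℝ, IsAdapted T w (ε n) (r n) Q :=
    fun n => hw.exists_isAdapted (hε0 n) (hr0 n)
  choose Q hQ using hQ
  set P : ℕ → Finset ℝ := fun n =>
    (((Finset.range (n + 1)).biUnion Q) ∪ {0, T}).filter fun p => p ∈ Icc 0 T with hP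
  have hPmono : Monotone P := by
    intro m n hmn
    refine Finset.filter_subset_filter _ (Finset.union_subset_union_left
      (Finset.biUnion_subset_biUnion_of_subset_left _ ?_))
    exact Finset.range_subset_range.2 (by omega)
  have hPT : ∀ n, ∀ p ∈ P n, p ∈ Icc 0 T := fun n p hp => (Finset.mem_filter.1 hp).2
  have hP0 : ∀ n, 0 ∈ P n := fun n => by simp [hP, hT.le]
  have hPA : ∀ n, IsAdapted T w (ε n) (r n) (P n) := by
    intro n u hu v hv huv h
    refine hQ n u hu v hv huv fun p hp hpI => h p ?_ hpI
    rw [hP, Finset.mem_filter]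
    exact ⟨Finset.mem_union_left _ (Finset.mem_biUnion.2 ⟨n, by simp, hp⟩),
      hu.1.trans hpI.1.le, hpI.2.trans hv.2⟩
  have hS : ∀ n, ∃ S : DiscreteSolution T D Γ w h, (∀ k, S.τ k ∈ P n) ∧
      (∀ p ∈ P n, ∃ k ≤ S.N, S.τ k = p) ∧ ∀ k, ‖S.l (k + 1) - S.l k‖ ≤ h * (c + 2 * ε n) :=
    fun n => exists_discreteSolution hh.le hproj hw hc hw₀ (hP0 n) (hPT n) hc0 (hε0 n).le
      (hr0 n).le (hPA n) (hrD n) (by linarith [hεle n])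
  choose S hSmem hSsurj hSstep using hS
  have hloc : ∀ m n, m ≤ n → ∀ u v, 0 ≤ u → u ≤ v → v ≤ T → (∀ q ∈ P m, q ∉ Ioc u v) →
      a * (S n).variation u v ≤ ‖(S n).refl v - (S n).refl u‖ ∧
        (S n).variation u v ≤ (C + 2 * h) * ε m := by
    intro m n hmn u v hu huv hv hq
    refine (S n).scheme.seqVariation_le hΓ (S n).mem_Icc hint ha he (hε0 m).le hh.le ?_
      (DiscreteSolution.isQuiet (fun q hq => hSsurj n q (hPmono hmn hq)) (hPA m) (hrD m) (hrη m)
        hu huv hq)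
    have : (C + 2 + 2 * h) * ε m ≤ (C + 2 + 2 * h) * ε₀ := by gcongr; exact hεle m
    linarith
  refine ⟨P, S, hPmono, hP0 0, by simp [hP, hT.le], fun n p => ⟨hSsurj n p, ?_⟩, ?_, ?_,
    fun n u v hu huv hv hq => (hloc 0 n (Nat.zero_le n) u v hu huv hv hq).1, ?_⟩
  · rintro ⟨k, -, rfl⟩
    exact hSmem n k
  · intro ε' hε'
    obtain ⟨m, hm⟩ := hεlim ε' hε'
    refine ⟨m, fun u hu v hv huv h => ?_⟩
    have := hPA m u hu v hv huv h
    exact ⟨this.1.trans hm, this.2.trans ((hrε m).trans hm)⟩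
  · intro ε' hε'
    have hA : 0 < C + 2 * h := by positivity
    obtain ⟨m, hm⟩ := hεlim (ε' / (C + 2 * h)) (by positivity)
    refine ⟨m, fun n hn u v hu huv hv hq => (hloc m n hn u v hu huv hv hq).2.trans ?_⟩
    rwa [mul_comm, ← le_div_iff₀ hA]
  · intro n u v hu huv hv hq
    have h1 : ∀ k, ‖(S n).l (k + 1) - (S n).l k‖ ≤ ρ / 4 := fun k =>
      (hSstep n k).trans (le_trans (by gcongr; exact hεle n) hε₃)
    have h2 := DiscreteSolution.variation_le_of_Ioo (S := S n) (Q := P 0) (b := ρ / 4)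
      (fun q hq => hSsurj n q (hPmono (Nat.zero_le n) hq)) h1 (fun u v hu huv hv hq => by
        refine (hloc 0 n (Nat.zero_le n) u v hu huv hv hq).2.trans (le_trans ?_ hε₁)
        have := hεle 0
        have h3 := (hε0 0).le
        gcongr
        linarith) hu huv hv hq
    linarith

/-! ### The variation measure -/

/-- The nearest point of `[0,T]`. -/
def clip (T t : ℝ) : ℝ := max 0 (min t T)

section Clip

variable {T : ℝ}

theorem clip_mem (hT : 0 ≤ T) (t : ℝ) : clip T t ∈ Icc 0 T :=
  ⟨le_max_left _ _, max_le hT (min_le_right _ _)⟩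

theorem clip_of_mem {t : ℝ} (ht : t ∈ Icc 0 T) : clip T t = t := by
  rw [clip, min_eq_left ht.2, max_eq_right ht.1]

theorem clip_mono : Monotone (clip T) :=
  fun _ _ h => max_le_max le_rfl (min_le_min h le_rfl)

theorem continuous_clip : Continuous (clip T) := by
  unfold clip; fun_prop

theorem continuousWithinAt_comp_clip {E : Type*} [TopologicalSpace E] {f : ℝ → E} (hT : 0 ≤ T)
    (hf : ∀ p ∈ Icc 0 T, ContinuousWithinAt f (Icc 0 T ∩ Ici p) p) (t : ℝ) :
    ContinuousWithinAt (fun s => f (clip T s)) (Ici t) t :=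
  (hf _ (clip_mem hT t)).comp continuous_clip.continuousWithinAt
    fun s hs => ⟨clip_mem hT s, clip_mono hs⟩

theorem continuousWithinAt_Icc_inter_Ici {E : Type*} [TopologicalSpace E] {f : ℝ → E}
    (hf : ∀ t ∈ Ico 0 T, ContinuousWithinAt f (Ioi t) t) {p : ℝ} (hp : p ∈ Icc 0 T) :
    ContinuousWithinAt f (Icc 0 T ∩ Ici p) p := by
  rcases hp.2.lt_or_eq with h | rfl
  · exact (continuousWithinAt_Ioi_iff_Ici.1 (hf p ⟨hp.1, h⟩)).mono inter_subset_right
  · refine continuousWithinAt_singleton.mono ?_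
    rintro y ⟨hy, hy'⟩
    exact le_antisymm hy.2 hy'

end Clip

section TotalVariation

variable {T : ℝ} {f : ℝ → Euc d}

theorem totalVariation_sub (hf : BoundedVariationOn f (Icc 0 T)) {s t : ℝ} (hs : 0 ≤ s)
    (hst : s ≤ t) (ht : t ≤ T) :
    totalVariation T f t - totalVariation T f s = (eVariationOn f (Icc s t)).toReal := by
  have h := eVariationOn.Icc_add_Icc f (s := univ) hs hst (mem_univ _)
  simp only [univ_inter] at h
  have hfin : ∀ u v, 0 ≤ u → v ≤ T → eVariationOn f (Icc u v) ≠ ⊤ := fun u v hu hv =>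
    ((eVariationOn.mono f (Icc_subset_Icc hu hv)).trans_lt (lt_top_iff_ne_top.2 hf)).ne
  rw [totalVariation, totalVariation, min_eq_left ht, min_eq_left (hst.trans ht), ← h,
    ENNReal.toReal_add (hfin _ _ le_rfl (hst.trans ht)) (hfin _ _ hs ht), add_sub_cancel_left]

theorem totalVariation_of_nonpos {t : ℝ} (ht : t ≤ 0) : totalVariation T f t = 0 := by
  rw [totalVariation, eVariationOn.subsingleton, ENNReal.toReal_zero]
  exact subsingleton_Icc_of_ge ((min_le_left _ _).trans ht)

theorem totalVariation_of_ge {t : ℝ} (ht : T ≤ t) :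
    totalVariation T f t = totalVariation T f T := by
  rw [totalVariation, totalVariation, min_eq_right ht, min_self]

theorem totalVariation_clip (hT : 0 ≤ T) (t : ℝ) :
    totalVariation T f (clip T t) = totalVariation T f t := by
  rcases le_total t 0 with h | h
  · rw [totalVariation_of_nonpos h, clip, min_eq_left (h.trans hT), max_eq_left h,
      totalVariation_of_nonpos le_rfl]
  rcases le_total t T with h' | h'
  · rw [clip_of_mem ⟨h, h'⟩]
  · rw [totalVariation_of_ge h', clip, min_eq_right h', max_eq_right hT]

theorem norm_sub_le_totalVariation_sub (hT : 0 ≤ T) (hf : BoundedVariationOn f (Icc 0 T))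
    {s t : ℝ} (hst : s ≤ t) :
    ‖f (clip T t) - f (clip T s)‖ ≤ totalVariation T f t - totalVariation T f s := by
  have hs := clip_mem hT s
  have ht := clip_mem hT t
  have hc := clip_mono (T := T) hst
  rw [← totalVariation_clip hT t, ← totalVariation_clip hT s, totalVariation_sub hf hs.1 hc ht.2,
    ← dist_eq_norm]
  exact (hf.mono (Icc_subset_Icc hs.1 ht.2)).dist_le (right_mem_Icc.2 hc) (left_mem_Icc.2 hc)

theorem continuousWithinAt_totalVariation (hT : 0 ≤ T) (hf : BoundedVariationOn f (Icc 0 T))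
    (hrc : ∀ t ∈ Ico 0 T, ContinuousWithinAt f (Ioi t) t) (t : ℝ) :
    ContinuousWithinAt (totalVariation T f) (Ici t) t := by
  have key : ∀ p ∈ Icc 0 T, ContinuousWithinAt (totalVariation T f) (Icc 0 T ∩ Ici p) p := by
    intro p hp
    have h1 := hf.tendsto_eVariationOn_Icc_zero_right p (continuousWithinAt_Icc_inter_Ici hrc hp)
    have h2 := ((ENNReal.tendsto_toReal ENNReal.zero_ne_top).comp h1).const_add
      (totalVariation T f p)
    rw [ENNReal.toReal_zero, add_zero] at h2
    refine (h2.mono_left (nhdsWithin_mono _ inter_subset_left)).congr' ?_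
    filter_upwards [self_mem_nhdsWithin] with y hy
    have hsub : Icc 0 T ∩ Icc p y = Icc p y :=
      inter_eq_right.2 (Icc_subset_Icc hp.1 hy.1.2)
    rw [Function.comp_apply, hsub, ← totalVariation_sub hf hp.1 hy.2 hy.1.2, add_sub_cancel]
  have := continuousWithinAt_comp_clip hT key t
  simpa only [totalVariation_clip hT] using this

theorem variationMeasure_eq (hf : BoundedVariationOn f (Icc 0 T)) :
    variationMeasure T f = (totalVariation_monotone hf).stieltjesFunction.measure := by
  rw [variationMeasure, dif_pos hf]

theorem stieltjesFunction_totalVariation (hT : 0 ≤ T) (hf : BoundedVariationOn f (Icc 0 T))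
    (hrc : ∀ t ∈ Ico 0 T, ContinuousWithinAt f (Ioi t) t) (t : ℝ) :
    (totalVariation_monotone hf).stieltjesFunction t = totalVariation T f t := by
  rw [Monotone.stieltjesFunction_eq]
  exact (continuousWithinAt_totalVariation hT hf hrc t).rightLim_eq

theorem variationMeasure_Ioc (hT : 0 ≤ T) (hf : BoundedVariationOn f (Icc 0 T))
    (hrc : ∀ t ∈ Ico 0 T, ContinuousWithinAt f (Ioi t) t) (s t : ℝ) :
    variationMeasure T f (Ioc s t) =
      ENNReal.ofReal (totalVariation T f t - totalVariation T f s) := by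
  rw [variationMeasure_eq hf, StieltjesFunction.measure_Ioc,
    stieltjesFunction_totalVariation hT hf hrc, stieltjesFunction_totalVariation hT hf hrc]

theorem variationMeasure_Iic_zero (hT : 0 ≤ T) (hf : BoundedVariationOn f (Icc 0 T))
    (hrc : ∀ t ∈ Ico 0 T, ContinuousWithinAt f (Ioi t) t) :
    variationMeasure T f (Iic 0) = 0 := by
  rw [variationMeasure_eq hf, StieltjesFunction.measure_Iic (l := 0),
    stieltjesFunction_totalVariation hT hf hrc, totalVariation_of_nonpos le_rfl]
  · simp
  · refine tendsto_const_nhds.congr' ?_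
    filter_upwards [eventually_le_atBot 0] with t ht
    rw [stieltjesFunction_totalVariation hT hf hrc, totalVariation_of_nonpos ht]

theorem variationMeasure_Ioi_right (hT : 0 ≤ T) (hf : BoundedVariationOn f (Icc 0 T))
    (hrc : ∀ t ∈ Ico 0 T, ContinuousWithinAt f (Ioi t) t) :
    variationMeasure T f (Ioi T) = 0 := by
  rw [variationMeasure_eq hf, StieltjesFunction.measure_Ioi (l := totalVariation T f T),
    stieltjesFunction_totalVariation hT hf hrc]
  · simp
  · refine tendsto_const_nhds.congr' ?_
    filter_upwards [eventually_ge_atTop T] with t ht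
    rw [stieltjesFunction_totalVariation hT hf hrc, totalVariation_of_ge ht]

theorem variationMeasure_univ (hT : 0 ≤ T) (hf : BoundedVariationOn f (Icc 0 T))
    (hrc : ∀ t ∈ Ico 0 T, ContinuousWithinAt f (Ioi t) t) :
    variationMeasure T f univ = ENNReal.ofReal (totalVariation T f T) := by
  have h1 : (univ : Set ℝ) = (Iic 0 ∪ Ioi T) ∪ Ioc 0 T := by
    ext t
    simp only [mem_univ, mem_union, mem_Iic, mem_Ioi, mem_Ioc, true_iff]
    grind
  refine le_antisymm ?_ ?_
  · rw [h1]
    refine (measure_union_le _ _).trans ?_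
    rw [measure_union_null (variationMeasure_Iic_zero hT hf hrc)
      (variationMeasure_Ioi_right hT hf hrc), variationMeasure_Ioc hT hf hrc,
      totalVariation_of_nonpos le_rfl, sub_zero, zero_add]
  · refine le_trans ?_ (measure_mono (subset_univ (Ioc 0 T)))
    rw [variationMeasure_Ioc hT hf hrc, totalVariation_of_nonpos le_rfl, sub_zero]

theorem isFiniteMeasure_variationMeasure (hT : 0 ≤ T) (hf : BoundedVariationOn f (Icc 0 T))
    (hrc : ∀ t ∈ Ico 0 T, ContinuousWithinAt f (Ioi t) t) :
    IsFiniteMeasure (variationMeasure T f) :=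
  ⟨by rw [variationMeasure_univ hT hf hrc]; exact ENNReal.ofReal_lt_top⟩

/-- A real right continuous function whose increments are bounded by those of the total variation
has a density with respect to the variation measure: adding the total variation makes it monotone,
and the resulting Stieltjes measure is at most twice the variation measure. -/
theorem exists_density_of_abs_sub_le (hT : 0 ≤ T) (hf : BoundedVariationOn f (Icc 0 T))
    (hrc : ∀ t ∈ Ico 0 T, ContinuousWithinAt f (Ioi t) t) {g : ℝ → ℝ}
    (hg : ∀ s t, s ≤ t → |g t - g s| ≤ totalVariation T f t - totalVariation T f s)
    (hgc : ∀ t, ContinuousWithinAt g (Ici t) t) :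
    ∃ θ : ℝ → ℝ, Integrable θ (variationMeasure T f) ∧
      ∀ s t, s ≤ t → ∫ r in Ioc s t, θ r ∂(variationMeasure T f) = g t - g s := by
  set μ := variationMeasure T f with hμ
  have : IsFiniteMeasure μ := isFiniteMeasure_variationMeasure hT hf hrc
  let F : StieltjesFunction ℝ :=
    { toFun := fun t => totalVariation T f t + g t
      mono' := fun s t hst => by
        have := (abs_le.1 (hg s t hst)).1
        linarith
      right_continuous' := fun t => (continuousWithinAt_totalVariation hT hf hrc t).add (hgc t) }
  let G : StieltjesFunction ℝ :=
    { toFun := fun t => totalVariation T f t - g t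
      mono' := fun s t hst => by
        have := (abs_le.1 (hg s t hst)).2
        linarith
      right_continuous' := fun t => (continuousWithinAt_totalVariation hT hf hrc t).sub (hgc t) }
  have hFG : F.measure + G.measure = μ + μ := by
    rw [← StieltjesFunction.measure_add, hμ, variationMeasure_eq hf,
      ← StieltjesFunction.measure_add]
    congr 1
    ext t
    rw [StieltjesFunction.add_apply, StieltjesFunction.add_apply,
      stieltjesFunction_totalVariation hT hf hrc]
    change (totalVariation T f t + g t) + (totalVariation T f t - g t) = _
    ring
  have hFle : F.measure ≤ μ + μ := by
    rw [← hFG]; exact Measure.le_add_right le_rfl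
  have : IsFiniteMeasure F.measure := isFiniteMeasure_of_le _ hFle
  have hac : F.measure ≪ μ := by
    refine (Measure.absolutelyContinuous_of_le hFle).trans (Measure.AbsolutelyContinuous.mk ?_)
    intro A _ hA
    simp [hA]
  have hint : Integrable (fun r => (F.measure.rnDeriv μ r).toReal) μ :=
    Measure.integrable_toReal_rnDeriv
  refine ⟨fun r => (F.measure.rnDeriv μ r).toReal - 1, hint.sub (integrable_const _), ?_⟩
  intro s t hst
  have hV : 0 ≤ totalVariation T f t - totalVariation T f s := (abs_nonneg _).trans (hg s t hst)
  have hF : F t - F s = (totalVariation T f t - totalVariation T f s) + (g t - g s) := by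
    change (totalVariation T f t + g t) - (totalVariation T f s + g s) = _
    ring
  rw [integral_sub hint.integrableOn (integrable_const _), Measure.setIntegral_toReal_rnDeriv hac,
    setIntegral_const, measureReal_def, measureReal_def, StieltjesFunction.measure_Ioc,
    hμ, variationMeasure_Ioc hT hf hrc, ENNReal.toReal_ofReal hV,
    ENNReal.toReal_ofReal (sub_nonneg.2 (F.mono hst)), hF]
  simp

end TotalVariation

/-! ### Lebesgue differentiation and the polar decomposition -/

section Averages

variable {E : Type*} [NormedAddCommGroup E] [NormedSpace ℝ E]
  {μ : Measure ℝ} {γ : ℝ → E}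

theorem tendsto_setIntegral_Ioc (hγ : Integrable γ μ) (a b : ℝ) :
    Tendsto (fun n : ℕ => ∫ r in Ioc (a - 1 / ((n : ℝ) + 1)) b, γ r ∂μ) atTop
      (𝓝 (∫ r in Icc a b, γ r ∂μ)) := by
  have hInter : ⋂ n : ℕ, Ioc (a - 1 / ((n : ℝ) + 1)) b = Icc a b := by
    ext x
    simp only [mem_iInter, mem_Ioc, mem_Icc]
    constructor
    · intro h
      refine ⟨?_, (h 0).2⟩
      by_contra! hcon
      obtain ⟨n, hn⟩ := exists_nat_one_div_lt (sub_pos.2 hcon)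
      linarith [(h n).1]
    · intro h n
      have : (0 : ℝ) < 1 / ((n : ℝ) + 1) := by positivity
      exact ⟨by linarith [h.1], h.2⟩
  rw [← hInter]
  refine tendsto_setIntegral_of_antitone (fun n => measurableSet_Ioc) ?_ ⟨0, hγ.integrableOn⟩
  intro m n hmn
  refine Ioc_subset_Ioc_left (sub_le_sub_left ?_ a)
  have : (m : ℝ) ≤ n := by exact_mod_cast hmn
  gcongr

/-- Lebesgue differentiation along two-sided intervals: a closed scale-invariant set that contains
the integrals over all small half-open intervals near `s` also contains the density at `s`. -/
theorem ae_mem_of_setIntegral_Ioc_mem [IsFiniteMeasure μ] [CompleteSpace E] (hγ : Integrable γ μ) :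
    ∀ᵐ s ∂μ, ∀ G : Set E, IsClosed G → (∀ c : ℝ, 0 < c → ∀ y ∈ G, c • y ∈ G) →
      (∃ δ > 0, ∀ u ∈ Ioo (s - δ) s, ∀ v ∈ Ioo s (s + δ), ∫ r in Ioc u v, γ r ∂μ ∈ G) →
      γ s ∈ G := by
  filter_upwards [(Besicovitch.vitaliFamily μ).ae_tendsto_average hγ.locallyIntegrable,
    (Besicovitch.vitaliFamily μ).ae_eventually_measure_pos] with s h1 h2 G hG hGc hGI
  obtain ⟨δ, hδ, hGI⟩ := hGI
  have h1 := h1.comp (Besicovitch.tendsto_filterAt μ s)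
  have h2 := (Besicovitch.tendsto_filterAt μ s).eventually h2
  refine hG.mem_of_tendsto h1 ?_
  filter_upwards [h2, Ioo_mem_nhdsGT hδ] with r hr hrδ
  rw [Function.comp_apply, setAverage_eq]
  have hpos : 0 < μ.real (closedBall s r) := ENNReal.toReal_pos hr.ne' (measure_ne_top _ _)
  refine hGc _ (inv_pos.2 hpos) _ ?_
  rw [Real.closedBall_eq_Icc]
  refine hG.mem_of_tendsto (tendsto_setIntegral_Ioc hγ (s - r) (s + r)) ?_
  have hlim : Tendsto (fun n : ℕ => 1 / ((n : ℝ) + 1)) atTop (𝓝 0) :=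
    tendsto_one_div_add_atTop_nhds_zero_nat
  filter_upwards [hlim.eventually (gt_mem_nhds (sub_pos.2 hrδ.2))] with n hn
  have : (0 : ℝ) < 1 / ((n : ℝ) + 1) := by positivity
  exact hGI _ ⟨by linarith, by linarith [hrδ.1]⟩ _ ⟨by linarith [hrδ.1], by linarith [hrδ.2]⟩

theorem ae_norm_le_one_of_norm_setIntegral_Ioc_le [IsFiniteMeasure μ] [CompleteSpace E]
    (hγ : Integrable γ μ)
    (h : ∀ s t, s ≤ t → ‖∫ r in Ioc s t, γ r ∂μ‖ ≤ μ.real (Ioc s t)) :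
    ∀ᵐ s ∂μ, ‖γ s‖ ≤ 1 := by
  have hIcc : ∀ a b, a ≤ b → ‖∫ r in Icc a b, γ r ∂μ‖ ≤ μ.real (Icc a b) := by
    intro a b hab
    have h1 := (tendsto_setIntegral_Ioc hγ a b).norm
    have h2 := tendsto_setIntegral_Ioc (μ := μ) (integrable_const (1 : ℝ)) a b
    simp only [setIntegral_const, smul_eq_mul, mul_one] at h2
    refine le_of_tendsto_of_tendsto' h1 h2 fun n => h _ _ ?_
    have : (0 : ℝ) < 1 / ((n : ℝ) + 1) := by positivity
    linarith
  filter_upwards [(Besicovitch.vitaliFamily μ).ae_tendsto_average hγ.locallyIntegrable] with s h1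
  have h1 := (h1.comp (Besicovitch.tendsto_filterAt μ s)).norm
  refine le_of_tendsto h1 ?_
  filter_upwards [self_mem_nhdsWithin] with r hr
  rw [Function.comp_apply, setAverage_eq, Real.closedBall_eq_Icc, norm_smul, norm_inv,
    Real.norm_of_nonneg measureReal_nonneg]
  have hr' : (0 : ℝ) < r := hr
  exact inv_mul_le_one_of_le₀ (hIcc _ _ (by linarith)) measureReal_nonneg

end Averages

/-- Polar decomposition: a right continuous function of bounded variation is the integral of a
unit vector field with respect to its variation measure. -/
theorem exists_polar {T : ℝ} {f : ℝ → Euc d} (hT : 0 ≤ T) (hf : BoundedVariationOn f (Icc 0 T))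
    (hrc : ∀ t ∈ Ico 0 T, ContinuousWithinAt f (Ioi t) t) :
    ∃ γ : ℝ → Euc d, Integrable γ (variationMeasure T f) ∧
      (∀ s t, s ≤ t → ∫ r in Ioc s t, γ r ∂(variationMeasure T f) =
        f (clip T t) - f (clip T s)) ∧
      ∀ᵐ s ∂(variationMeasure T f), ‖γ s‖ = 1 := by
  have := isFiniteMeasure_variationMeasure hT hf hrc
  have hcoord : ∀ i : Fin d, ∃ θ : ℝ → ℝ, Integrable θ (variationMeasure T f) ∧
      ∀ s t, s ≤ t → ∫ r in Ioc s t, θ r ∂(variationMeasure T f) =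
        f (clip T t) i - f (clip T s) i := by
    intro i
    refine exists_density_of_abs_sub_le hT hf hrc (g := fun t => f (clip T t) i) ?_ ?_
    · intro s t hst
      refine le_trans ?_ (norm_sub_le_totalVariation_sub hT hf hst)
      have := PiLp.norm_apply_le (f (clip T t) - f (clip T s)) i
      simpa using this
    · intro t
      have h1 := continuousWithinAt_comp_clip hT
        (fun p hp => continuousWithinAt_Icc_inter_Ici hrc hp) t
      have h2 : Continuous fun y : Euc d => y i := by fun_prop
      exact h2.continuousAt.comp_continuousWithinAt h1
  choose θ hθ hθI using hcoord
  set γ : ℝ → Euc d := fun s => WithLp.toLp 2 fun i => θ i s with hγdef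
  have hγ : Integrable γ (variationMeasure T f) := Integrable.of_eval_piLp fun i => hθ i
  have hγI : ∀ s t, s ≤ t → ∫ r in Ioc s t, γ r ∂(variationMeasure T f) =
      f (clip T t) - f (clip T s) := by
    intro s t hst
    ext i
    rw [eval_integral_piLp (f := γ) (μ := (variationMeasure T f).restrict (Ioc s t))
      fun j => (hθ j).integrableOn]
    simpa using hθI i s t hst
  have hle : ∀ᵐ s ∂(variationMeasure T f), ‖γ s‖ ≤ 1 := by
    refine ae_norm_le_one_of_norm_setIntegral_Ioc_le hγ fun s t hst => ?_
    have h1 := norm_sub_le_totalVariation_sub hT hf hst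
    rw [hγI s t hst, measureReal_def, variationMeasure_Ioc hT hf hrc,
      ENNReal.toReal_ofReal ((norm_nonneg _).trans h1)]
    exact h1
  refine ⟨γ, hγ, hγI, ?_⟩
  have hnn : 0 ≤ᵐ[variationMeasure T f] fun s => 1 - ‖γ s‖ := by
    filter_upwards [hle] with s hs
    simpa using hs
  have hint : Integrable (fun s => 1 - ‖γ s‖) (variationMeasure T f) :=
    (integrable_const _).sub hγ.norm
  -- the variation of `f` is at most the integral of `‖γ‖`, so the total mass is not larger
  have hvar : totalVariation T f T ≤ ∫ s, ‖γ s‖ ∂(variationMeasure T f) := by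
    have h1 : eVariationOn f (Icc 0 T) ≤
        ENNReal.ofReal ((∫ s in Ioc 0 T, ‖γ s‖ ∂(variationMeasure T f)) -
          ∫ s in Ioc 0 0, ‖γ s‖ ∂(variationMeasure T f)) := by
      refine eVariationOn_le_of_norm_sub_le
        (G := fun t => ∫ s in Ioc 0 t, ‖γ s‖ ∂(variationMeasure T f)) ?_
      intro s hs t ht hst
      have h2 := hγI s t hst
      rw [clip_of_mem hs, clip_of_mem ht] at h2
      have h3 : (∫ r in Ioc 0 t, ‖γ r‖ ∂(variationMeasure T f)) =
          (∫ r in Ioc 0 s, ‖γ r‖ ∂(variationMeasure T f)) +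
            ∫ r in Ioc s t, ‖γ r‖ ∂(variationMeasure T f) := by
        rw [← Ioc_union_Ioc_eq_Ioc hs.1 hst, setIntegral_union (Ioc_disjoint_Ioc_of_le le_rfl)
          measurableSet_Ioc hγ.norm.integrableOn hγ.norm.integrableOn]
      simp only [h3, add_sub_cancel_left, ← h2]
      exact norm_integral_le_integral_norm _
    rw [Ioc_self, Measure.restrict_empty, integral_zero_measure, sub_zero] at h1
    have h4 := ENNReal.toReal_mono ENNReal.ofReal_ne_top h1
    rw [ENNReal.toReal_ofReal (integral_nonneg fun _ => norm_nonneg _)] at h4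
    rw [totalVariation, min_self]
    exact h4.trans (setIntegral_le_integral hγ.norm (ae_of_all _ fun _ => norm_nonneg _))
  have hzero : ∫ s, (1 - ‖γ s‖) ∂(variationMeasure T f) = 0 := by
    refine le_antisymm ?_ (integral_nonneg_of_ae hnn)
    rw [integral_sub (integrable_const _) hγ.norm, integral_const, measureReal_def,
      variationMeasure_univ hT hf hrc, smul_eq_mul, mul_one, ENNReal.toReal_ofReal]
    · linarith
    · exact ENNReal.toReal_nonneg
  filter_upwards [(integral_eq_zero_iff_of_nonneg_ae hnn hint).1 hzero] with s hs
  have : 1 - ‖γ s‖ = 0 := hs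
  linarith

/-! ### The limit of the discrete solutions -/

theorem eventually_forall_notMem_Ioc (Q : Finset ℝ) (t : ℝ) :
    ∀ᶠ y in 𝓝[>] t, ∀ q ∈ Q, q ∉ Ioc t y := by
  rw [Filter.eventually_all_finset]
  intro q _
  rcases le_or_gt q t with h | h
  · exact Eventually.of_forall fun y hy => hy.1.not_ge h
  · filter_upwards [Ioo_mem_nhdsGT h] with y hy hq
    exact hy.2.not_ge hq.2

theorem eventually_forall_notMem_Ico (Q : Finset ℝ) (t : ℝ) :
    ∀ᶠ y in 𝓝[<] t, ∀ q ∈ Q, q ∉ Ico y t := by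
  rw [Filter.eventually_all_finset]
  intro q _
  rcases le_or_gt t q with h | h
  · exact Eventually.of_forall fun y hy => hy.2.not_ge h
  · filter_upwards [Ioo_mem_nhdsLT h] with y hy hq
    exact hy.1.not_ge hq.1

namespace IsApproximation

variable {T : ℝ} {D : Set (ℝ × Euc d)} {Γ : ℝ → Euc d → Set (Euc d)} {w : ℝ → Euc d} {h a b : ℝ}
  {P : ℕ → Finset ℝ} {S : ℕ → DiscreteSolution T D Γ w h}

theorem variation_le (hA : IsApproximation a b P S) (n : ℕ) {u v : ℝ} (hu : 0 ≤ u) (huv : u ≤ v)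
    (hv : v ≤ T) : (S n).variation u v ≤ ((P 0).card + 1) * b := by
  refine DiscreteSolution.variation_le_card ?_ (hA.jump n) hu huv hv
  have h1 := hA.jump n v v (hu.trans huv) le_rfl hv (by simp)
  exact (DiscreteSolution.variation_nonneg _ _).trans h1

/-- The reflection terms converge pointwise along an ultrafilter. The limit is continued by
constants outside `[0,T]`. -/
theorem exists_limit (hA : IsApproximation a b P S) (hT : 0 ≤ T) :
    ∃ l : ℝ → Euc d, (∀ t, l (clip T t) = l t) ∧
      ∀ t ∈ Icc 0 T, Tendsto (fun n => (S n).refl t) (hyperfilter ℕ) (𝓝 (l t)) := by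
  have key : ∀ t ∈ Icc 0 T, ∃ y, Tendsto (fun n => (S n).refl t) (hyperfilter ℕ) (𝓝 y) := by
    intro t ht
    obtain ⟨y, -, hy⟩ := (isCompact_closedBall (0 : Euc d)
      (((P 0).card + 1) * b)).ultrafilter_le_nhds ((hyperfilter ℕ).map fun n => (S n).refl t) (by
        rw [Ultrafilter.coe_map, le_principal_iff, mem_map]
        refine univ_mem' fun n => ?_
        rw [mem_preimage, mem_closedBall_zero_iff]
        have h1 := DiscreteSolution.norm_refl_sub_le (S := S n) le_rfl ht.1
        rw [DiscreteSolution.refl_zero, sub_zero] at h1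
        exact h1.trans (hA.variation_le n le_rfl ht.1 ht.2))
    exact ⟨y, hy⟩
  choose! y hy using key
  refine ⟨fun t => y (clip T t), fun t => by simp only [clip_of_mem (clip_mem hT t)],
    fun t ht => ?_⟩
  simp only [clip_of_mem ht]
  exact hy t ht

theorem exists_norm_sub_index_le (hA : IsApproximation a b P S) {ε : ℝ} (hε : 0 < ε) :
    ∃ m, ∀ n ≥ m, ∀ t ∈ Icc 0 T, ‖w t - w ((S n).τ ((S n).index t))‖ ≤ ε ∧
      t - (S n).τ ((S n).index t) ≤ ε := by
  obtain ⟨m, hm⟩ := hA.adapted ε hε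
  refine ⟨m, fun n hn t ht => hm _ ((S n).mem_Icc _) t ht (DiscreteSolution.τ_index_le ht.1) ?_⟩
  intro q hq hqI
  obtain ⟨k, hk, rfl⟩ := (hA.mem_iff n q).1 (hA.monotone hn hq)
  exact hqI.1.not_ge ((S n).monotone ((DiscreteSolution.le_index_iff ht.1 hk).2 hqI.2))

variable {U : Filter ℕ} {l : ℝ → Euc d}

theorem eVariationOn_le [U.NeBot]
    (hlim : ∀ t ∈ Icc 0 T, Tendsto (fun n => (S n).refl t) U (𝓝 (l t))) {u v ε : ℝ} (hu : 0 ≤ u)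
    (hv : v ≤ T) (hε : ∀ᶠ n in U, (S n).variation u v ≤ ε) :
    eVariationOn l (Icc u v) ≤ ENNReal.ofReal ε := by
  by_contra! hcon
  have h1 := eVariationOn.lowerSemicontinuous_aux (p := U) (F := fun n => (S n).refl)
    (fun t ht => hlim t ⟨hu.trans ht.1, ht.2.trans hv⟩) hcon
  obtain ⟨n, hn1, hn2⟩ := (h1.and hε).exists
  exact (hn1.trans_le ((DiscreteSolution.eVariationOn_refl_le hu).trans
    (ENNReal.ofReal_le_ofReal hn2))).false

theorem boundedVariationOn (hA : IsApproximation a b P S) [U.NeBot]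
    (hlim : ∀ t ∈ Icc 0 T, Tendsto (fun n => (S n).refl t) U (𝓝 (l t))) (hT : 0 ≤ T) :
    BoundedVariationOn l (Icc 0 T) :=
  ((eVariationOn_le hlim le_rfl le_rfl (Eventually.of_forall fun n =>
    hA.variation_le n le_rfl hT le_rfl)).trans_lt ENNReal.ofReal_lt_top).ne

theorem norm_sub_le [U.NeBot]
    (hlim : ∀ t ∈ Icc 0 T, Tendsto (fun n => (S n).refl t) U (𝓝 (l t))) {u v ε : ℝ} (hu : 0 ≤ u)
    (huv : u ≤ v) (hv : v ≤ T) (hε : ∀ᶠ n in U, (S n).variation u v ≤ ε) :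
    ‖l v - l u‖ ≤ ε :=
  le_of_tendsto ((hlim v ⟨hu.trans huv, hv⟩).sub (hlim u ⟨hu, huv.trans hv⟩)).norm
    (hε.mono fun _ hn => (DiscreteSolution.norm_refl_sub_le hu huv).trans hn)

theorem exists_norm_sub_le (hA : IsApproximation a b P S) [U.NeBot] (hU : U ≤ atTop)
    (hlim : ∀ t ∈ Icc 0 T, Tendsto (fun n => (S n).refl t) U (𝓝 (l t))) {ε : ℝ} (hε : 0 < ε) :
    ∃ m, ∀ u v, 0 ≤ u → u ≤ v → v ≤ T → (∀ q ∈ P m, q ∉ Ioc u v) → ‖l v - l u‖ ≤ ε := by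
  obtain ⟨m, hm⟩ := hA.small ε hε
  refine ⟨m, fun u v hu huv hv hq => norm_sub_le hlim hu huv hv (hU ?_)⟩
  filter_upwards [eventually_ge_atTop m] with n hn
  exact hm n hn u v hu huv hv hq

theorem isCadlag (hA : IsApproximation a b P S) [U.NeBot] (hU : U ≤ atTop)
    (hlim : ∀ t ∈ Icc 0 T, Tendsto (fun n => (S n).refl t) U (𝓝 (l t))) : IsCadlag T l := by
  constructor
  · intro t ht
    rw [ContinuousWithinAt, Metric.tendsto_nhds]
    intro ε hε
    obtain ⟨m, hm⟩ := hA.exists_norm_sub_le hU hlim (half_pos hε)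
    filter_upwards [eventually_forall_notMem_Ioc (P m) t, Ioo_mem_nhdsGT ht.2] with y hy hyT
    rw [dist_eq_norm]
    exact (hm t y ht.1 hyT.1.le hyT.2.le hy).trans_lt (half_lt_self hε)
  · intro t ht
    have hT : 0 ≤ T := ht.1.le.trans ht.2
    obtain ⟨y, hy⟩ := (hA.boundedVariationOn hlim hT).exists_tendsto_left t
    refine ⟨y, hy.mono_left ?_⟩
    refine le_inf nhdsWithin_le_nhds ?_
    rw [le_principal_iff]
    filter_upwards [Ioo_mem_nhdsLT ht.1] with s hs
    exact ⟨⟨hs.1.le, hs.2.le.trans ht.2⟩, hs.2⟩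

theorem norm_sub_left_limit_le (hA : IsApproximation a b P S) [U.NeBot]
    (hlim : ∀ t ∈ Icc 0 T, Tendsto (fun n => (S n).refl t) U (𝓝 (l t))) {t : ℝ} (ht : t ∈ Ioc 0 T)
    {y : Euc d} (hy : Tendsto l (𝓝[<] t) (𝓝 y)) : ‖l t - y‖ ≤ b := by
  refine le_of_tendsto (hy.const_sub _).norm ?_
  filter_upwards [eventually_forall_notMem_Ico (P 0) t, Ioo_mem_nhdsLT ht.1] with u hu hu0
  refine norm_sub_le hlim hu0.1.le hu0.2.le ht.2 (Eventually.of_forall fun n => ?_)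
  exact hA.jump n u t hu0.1.le hu0.2.le ht.2 fun q hq hqI => hu q hq ⟨hqI.1.le, hqI.2⟩

theorem tendsto_position (hA : IsApproximation a b P S) (hU : U ≤ atTop)
    (hlim : ∀ t ∈ Icc 0 T, Tendsto (fun n => (S n).refl t) U (𝓝 (l t))) {t : ℝ}
    (ht : t ∈ Icc 0 T) :
    Tendsto (fun n => (S n).x ((S n).index t)) U (𝓝 (w t + l t)) := by
  have h1 : Tendsto (fun n => w ((S n).τ ((S n).index t))) U (𝓝 (w t)) := by
    refine Tendsto.mono_left (Metric.tendsto_atTop.2 fun ε hε => ?_) hU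
    obtain ⟨m, hm⟩ := hA.exists_norm_sub_index_le (half_pos hε)
    refine ⟨m, fun n hn => ?_⟩
    rw [dist_comm, dist_eq_norm]
    exact (hm n hn t ht).1.trans_lt (half_lt_self hε)
  refine (h1.add (hlim t ht)).congr fun n => ?_
  rw [(S n).scheme.decomposition, DiscreteSolution.refl]

theorem mem_closure (hA : IsApproximation a b P S) [U.NeBot] (hU : U ≤ atTop)
    (hl : Tendsto (timeModulus T D) (𝓝[>] 0) (𝓝 0))
    (hlim : ∀ t ∈ Icc 0 T, Tendsto (fun n => (S n).refl t) U (𝓝 (l t))) {t : ℝ}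
    (ht : t ∈ Icc 0 T) : w t + l t ∈ closure (slice D t) := by
  rw [Metric.mem_closure_iff]
  intro ε hε
  obtain ⟨r, hr, hD⟩ := exists_slicesClose hl (half_pos hε)
  obtain ⟨m, hm⟩ := hA.exists_norm_sub_index_le hr
  have h1 := (Metric.tendsto_nhds.1 (hA.tendsto_position hU hlim ht)) (ε / 2) (half_pos hε)
  obtain ⟨n, hn, hnm⟩ := (h1.and (hU (eventually_ge_atTop m))).exists
  obtain ⟨z, hz, hzd⟩ := hD _ ((S n).mem_Icc ((S n).index t)) t ht (by
    rw [abs_sub_comm, abs_of_nonneg (sub_nonneg.2 (DiscreteSolution.τ_index_le ht.1))]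
    exact (hm n hnm t ht).2) _ ((S n).scheme.mem_closure _)
  refine ⟨z, hz, (dist_triangle _ ((S n).x ((S n).index t)) _).trans_lt ?_⟩
  rw [dist_comm] at hn
  linarith

end IsApproximation

theorem IsCadlag.add {T : ℝ} {f g : ℝ → Euc d} (hf : IsCadlag T f) (hg : IsCadlag T g) :
    IsCadlag T fun t => f t + g t where
  right_continuous t ht := (hf.right_continuous t ht).add (hg.right_continuous t ht)
  left_limit t ht := by
    obtain ⟨y, hy⟩ := hf.left_limit t ht
    obtain ⟨z, hz⟩ := hg.left_limit t ht
    exact ⟨y + z, hy.add hz⟩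

/-! ### The direction of reflection in the limit -/

theorem isClosedConvexCone_zero : IsClosedConvexCone ({0} : Set (Euc d)) where
  nonempty := singleton_nonempty 0
  closed := isClosed_singleton
  combination α β _ _ u hu v hv := by
    rw [mem_singleton_iff] at hu hv ⊢
    simp [hu, hv]

/-- The cone over `(s, z)` in the graph of `Γ`, completed by `0`. It is reduced to `0` if `z` is
not a boundary point, so that this case needs no separate treatment. -/
theorem exists_cone_over {T : ℝ} {D : Set (ℝ × Euc d)} {Γ : ℝ → Euc d → Set (Euc d)}
    (hΓ : ∀ t ∈ Icc 0 T, ∀ z ∈ bdry D t, IsClosedConvexCone (Γ t z)) (s : ℝ) (z : Euc d) :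
    ∃ K : Set (Euc d), IsClosedConvexCone K ∧ (∀ g, (s, z, g) ∈ coneGraph T D Γ → g ∈ K) ∧
      ∀ g ∈ K, g ≠ 0 → (s, z, g) ∈ coneGraph T D Γ := by
  by_cases hsz : s ∈ Icc 0 T ∧ z ∈ bdry D s
  · exact ⟨Γ s z, hΓ s hsz.1 z hsz.2, fun g hg => hg.2.2, fun g hg _ => ⟨hsz.1, hsz.2, hg⟩⟩
  · exact ⟨{0}, isClosedConvexCone_zero, fun g hg => absurd ⟨hg.1, hg.2.1⟩ hsz,
      fun g hg h0 => absurd hg h0⟩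

/-- Upper semicontinuity of the cones, from the closedness of their graph and the compactness of
the unit sphere. -/
theorem exists_dist_lt_of_mem_coneGraph {T : ℝ} {D : Set (ℝ × Euc d)}
    {Γ : ℝ → Euc d → Set (Euc d)} (hclosed : IsClosed (coneGraph T D Γ)) {s : ℝ} {z : Euc d}
    {K : Set (Euc d)} (hK : ∀ g, (s, z, g) ∈ coneGraph T D Γ → g ∈ K) (hKne : K.Nonempty)
    {κ : ℝ} (hκ : 0 < κ) :
    ∃ δ > 0, ∀ t y g, (t, y, g) ∈ coneGraph T D Γ → |t - s| < δ → ‖y - z‖ < δ → ‖g‖ = 1 →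
      ∃ p ∈ K, ‖g - p‖ ≤ κ := by
  set B : Set (ℝ × Euc d × Euc d) := (coneGraph T D Γ ∩ {p | κ ≤ infDist p.2.2 K}) ∩
    closedBall s 1 ×ˢ closedBall z 1 ×ˢ sphere 0 1 with hB
  have hBc : IsCompact B := by
    refine IsCompact.inter_left ?_ (hclosed.inter ?_)
    · exact (isCompact_closedBall s 1).prod ((isCompact_closedBall z 1).prod (isCompact_sphere 0 1))
    · refine isClosed_le continuous_const ?_
      exact (continuous_infDist_pt K).comp (continuous_snd.comp continuous_snd)
  have hproj : IsClosed ((fun p : ℝ × Euc d × Euc d => (p.1, p.2.1)) '' B) :=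
    (hBc.image (by fun_prop)).isClosed
  have hsz : (s, z) ∉ (fun p : ℝ × Euc d × Euc d => (p.1, p.2.1)) '' B := by
    rintro ⟨⟨t, y, g⟩, ⟨⟨hg, hgK⟩, -⟩, heq⟩
    rw [Prod.mk.injEq] at heq
    obtain ⟨rfl, rfl⟩ := heq
    have h1 : κ ≤ infDist g K := hgK
    rw [infDist_zero_of_mem (hK g hg)] at h1
    exact h1.not_gt hκ
  obtain ⟨δ, hδ, hball⟩ := Metric.isOpen_iff.1 hproj.isOpen_compl _ hsz
  refine ⟨min δ 1, lt_min hδ one_pos, fun t y g hg ht hy hg1 => ?_⟩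
  by_contra! hcon
  refine hball (show (t, y) ∈ ball (s, z) δ from ?_) ⟨(t, y, g), ⟨⟨hg, ?_⟩, ?_, ?_, ?_⟩, rfl⟩
  · rw [mem_ball, Prod.dist_eq, max_lt_iff, Real.dist_eq, dist_eq_norm]
    exact ⟨ht.trans_le (min_le_left _ _), hy.trans_le (min_le_left _ _)⟩
  · refine (le_infDist hKne).2 fun p hp => ?_
    rw [dist_eq_norm]
    exact (hcon p hp).le
  · rw [mem_closedBall, Real.dist_eq]
    exact (ht.trans_le (min_le_right _ _)).le
  · rw [mem_closedBall, dist_eq_norm]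
    exact (hy.trans_le (min_le_right _ _)).le
  · rwa [mem_sphere_zero_iff_norm]

/-- The vectors at relative distance at most `θ` from a cone form a scale-invariant set. -/
theorem IsClosedConvexCone.infDist_smul_le {K : Set (Euc d)} (hK : IsClosedConvexCone K)
    {θ c : ℝ} (hc : 0 < c) {y : Euc d} (hy : infDist y K ≤ θ * ‖y‖) :
    infDist (c • y) K ≤ θ * ‖c • y‖ := by
  obtain ⟨p, hp, hpy⟩ := hK.closed.exists_infDist_eq_dist hK.nonempty y
  calc infDist (c • y) K ≤ dist (c • y) (c • p) := infDist_le_dist_of_mem (hK.smul_mem hc.le hp)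
    _ = c * infDist y K := by rw [dist_smul₀, Real.norm_of_nonneg hc.le, hpy]
    _ ≤ c * (θ * ‖y‖) := by gcongr
    _ = θ * ‖c • y‖ := by rw [norm_smul, Real.norm_of_nonneg hc.le]; ring

namespace IsApproximation

variable {T : ℝ} {D : Set (ℝ × Euc d)} {Γ : ℝ → Euc d → Set (Euc d)} {w : ℝ → Euc d} {h a b : ℝ}
  {P : ℕ → Finset ℝ} {S : ℕ → DiscreteSolution T D Γ w h} {U : Filter ℕ} {l : ℝ → Euc d}

/-- At a time `s` which belongs to the partitions, the jumps of the discrete solutions at `s`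
converge to the jump of the limit, so the latter lies in the cone. -/
theorem mem_coneGraph_of_jump (hA : IsApproximation a b P S) [U.NeBot] (hU : U ≤ atTop)
    (hclosed : IsClosed (coneGraph T D Γ))
    (hlim : ∀ t ∈ Icc 0 T, Tendsto (fun n => (S n).refl t) U (𝓝 (l t))) {s : ℝ} {m : ℕ}
    (hs : s ∈ P m) (hs0 : 0 < s) (hsT : s ≤ T) {y : Euc d} (hy0 : y ≠ 0) {u : ℕ → ℝ}
    (hus : ∀ i, u i < s) (hu : Tendsto u atTop (𝓝 s))
    (hy : Tendsto (fun i => l s - l (u i)) atTop (𝓝 y)) :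
    (s, w s + l s, y) ∈ coneGraph T D Γ := by
  have hsI : s ∈ Icc 0 T := ⟨hs0.le, hsT⟩
  have hidx : ∀ n ≥ m, (S n).index s ≤ (S n).N ∧ (S n).τ ((S n).index s) = s := by
    intro n hn
    obtain ⟨k, hk, rfl⟩ := (hA.mem_iff n s).1 (hA.monotone hn hs)
    rw [DiscreteSolution.index_τ hk]
    exact ⟨hk, rfl⟩
  have hjump : Tendsto (fun n => (S n).l ((S n).index s) - (S n).l ((S n).index s - 1)) U
      (𝓝 y) := by
    rw [Metric.tendsto_nhds]
    intro ε hε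
    have hε3 : 0 < ε / 4 := by positivity
    obtain ⟨m', hm'⟩ := hA.small _ hε3
    have hu' : Tendsto u atTop (𝓝[<] s) :=
      tendsto_nhdsWithin_iff.2 ⟨hu, Eventually.of_forall hus⟩
    obtain ⟨i, ⟨hi1, hi2⟩, hi3⟩ := ((hu'.eventually (eventually_forall_notMem_Ico (P m') s)).and
      (hu'.eventually (Ioo_mem_nhdsLT hs0)) |>.and (Metric.tendsto_nhds.1 hy _ hε3)).exists
    have huI : u i ∈ Icc 0 T := ⟨hi2.1.le, hi2.2.le.trans hsT⟩
    have h1 := Metric.tendsto_nhds.1 ((hlim s hsI).sub (hlim (u i) huI)) _ hε3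
    filter_upwards [h1, hU (eventually_ge_atTop m), hU (eventually_ge_atTop m')] with n hn1 hnm hnm'
    obtain ⟨hk, hτ⟩ := hidx n hnm
    obtain ⟨-, u', huu', hu's, hu'k⟩ := DiscreteSolution.exists_index_eq_pred (S := S n) hk huI.1
      (by rw [hτ]; exact hus i)
    rw [hτ] at hu's
    have h2 := hm' n hnm' (u i) u' huI.1 huu' (hu's.le.trans hsT)
      fun q hq hqI => hi1 q hq ⟨hqI.1.le, hqI.2.trans_lt hu's⟩
    have h3 := (DiscreteSolution.norm_refl_sub_le (S := S n) huI.1 huu').trans h2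
    rw [dist_eq_norm] at hn1 hi3 ⊢
    have h4 : (S n).l ((S n).index s) - (S n).l ((S n).index s - 1) - y =
        ((S n).refl s - (S n).refl (u i) - (l s - l (u i))) + (l s - l (u i) - y) -
          ((S n).refl u' - (S n).refl (u i)) := by
      simp only [DiscreteSolution.refl, hu'k]
      abel
    rw [h4]
    refine (_root_.norm_sub_le _ _).trans_lt ?_
    have h5 := norm_add_le ((S n).refl s - (S n).refl (u i) - (l s - l (u i))) (l s - l (u i) - y)
    linarith
  have hev : ∀ᶠ n in U, (s, (S n).x ((S n).index s),
      (S n).l ((S n).index s) - (S n).l ((S n).index s - 1)) ∈ coneGraph T D Γ := by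
    filter_upwards [hjump.eventually_ne hy0, hU (eventually_ge_atTop m)] with n hne hnm
    obtain ⟨hk, hτ⟩ := hidx n hnm
    have hk1 : 1 ≤ (S n).index s := by
      refine Nat.one_le_iff_ne_zero.2 fun h0 => hs0.ne' ?_
      rw [← hτ, h0, (S n).zero]
    obtain ⟨j, hj⟩ := Nat.exists_eq_add_of_le' hk1
    rw [hj] at hτ hne ⊢
    rw [Nat.add_sub_cancel] at hne ⊢
    have := (S n).scheme.reflection j (sub_ne_zero.1 hne)
    rw [hτ] at this
    exact ⟨hsI, this⟩
  exact hclosed.mem_of_tendsto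
    (tendsto_const_nhds.prodMk_nhds ((hA.tendsto_position hU hlim hsI).prodMk_nhds hjump)) hev

/-- Near a time `s` which belongs to none of the partitions, the increments of the limit are
almost contained in the cone at `s`. -/
theorem exists_infDist_sub_le (hA : IsApproximation a b P S) [U.NeBot] (hU : U ≤ atTop)
    (hΓ : ∀ t ∈ Icc 0 T, ∀ z ∈ bdry D t, IsClosedConvexCone (Γ t z)) (ha : 0 < a)
    (hclosed : IsClosed (coneGraph T D Γ))
    (hlim : ∀ t ∈ Icc 0 T, Tendsto (fun n => (S n).refl t) U (𝓝 (l t))) {s : ℝ}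
    (hs : ∀ m, s ∉ P m) (hs0 : 0 < s) (hsT : s < T) {K : Set (Euc d)} (hK : IsClosedConvexCone K)
    (hKs : ∀ g, (s, w s + l s, g) ∈ coneGraph T D Γ → g ∈ K) {κ : ℝ} (hκ : 0 < κ) :
    ∃ δ > 0, ∀ u ∈ Ioo (s - δ) s, ∀ v ∈ Ioo s (s + δ),
      infDist (l v - l u) K ≤ κ / a * ‖l v - l u‖ := by
  have hsI : s ∈ Icc 0 T := ⟨hs0.le, hsT.le⟩
  obtain ⟨δ, hδ, hdir⟩ := exists_dist_lt_of_mem_coneGraph hclosed hKs hK.nonempty hκ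
  have hδ4 : 0 < δ / 4 := by positivity
  obtain ⟨m₁, hm₁⟩ := hA.small _ hδ4
  obtain ⟨m₂, hm₂⟩ := hA.adapted _ hδ4
  have hnhds : Ioo 0 T ∩ ((P (max m₁ m₂) : Set ℝ))ᶜ ∈ 𝓝 s :=
    inter_mem (Ioo_mem_nhds hs0 hsT)
      ((P (max m₁ m₂)).finite_toSet.isClosed.isOpen_compl.mem_nhds (hs _))
  obtain ⟨δ', hδ', hball⟩ := Metric.mem_nhds_iff.1 hnhds
  rw [Real.ball_eq_Ioo] at hball
  set r := min δ' δ with hr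
  have hrδ' : r ≤ δ' := min_le_left _ _
  have hrδ : r ≤ δ := min_le_right _ _
  have hr0 : 0 < r := lt_min hδ' hδ
  have hrI : Ioo (s - r) (s + r) ⊆ Ioo 0 T ∩ ((P (max m₁ m₂) : Set ℝ))ᶜ :=
    (Ioo_subset_Ioo (by linarith) (by linarith)).trans hball
  refine ⟨r, hr0, fun u hu v hv => ?_⟩
  have huI := (hrI ⟨hu.1, by linarith [hu.2]⟩).1
  have hvI := (hrI ⟨by linarith [hv.1], hv.2⟩).1
  have hnone : ∀ m ≤ max m₁ m₂, ∀ q ∈ P m, q ∉ Ioc u v := fun m hm q hq hqI =>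
    (hrI ⟨hu.1.trans hqI.1, hqI.2.trans_lt hv.2⟩).2 (hA.monotone hm hq)
  have huv : u ≤ v := (hu.2.trans hv.1).le
  have hu0 : 0 ≤ u := huI.1.le
  have hinc := (hlim v ⟨hvI.1.le, hvI.2.le⟩).sub (hlim u ⟨hu0, huI.2.le⟩)
  refine le_of_tendsto_of_tendsto (((continuous_infDist_pt K).tendsto _).comp hinc)
    (hinc.norm.const_mul (κ / a)) ?_
  filter_upwards [Metric.tendsto_nhds.1 (hlim s hsI) _ hδ4, hU (eventually_ge_atTop m₁)]
    with n hn hnm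
  obtain ⟨p, hp, hpn⟩ := (S n).scheme.infDist_sub_le hΓ (S n).mem_Icc hK (κ := κ)
    (DiscreteSolution.index_mono (S := S n) hu0 huv) (by
      intro k hik hkj hne γ hγ
      have hkN : k + 1 ≤ (S n).N := hkj.trans_le (DiscreteSolution.index_le v)
      have htv : (S n).τ (k + 1) ≤ v := (DiscreteSolution.le_index_iff (hu0.trans huv) hkN).1 hkj
      have htu : u < (S n).τ (k + 1) := by
        by_contra! hcon
        have := (DiscreteSolution.le_index_iff hu0 hkN).2 hcon
        omega
      have hl : (S n).refl ((S n).τ (k + 1)) = (S n).l (k + 1) := by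
        rw [DiscreteSolution.refl, DiscreteSolution.index_τ hkN]
      have ht := (S n).mem_Icc (k + 1)
      have hdec := (S n).scheme.decomposition (k + 1)
      have hrefl := (S n).scheme.reflection k hne
      generalize hteq : (S n).τ (k + 1) = t at *
      have hts : |t - s| < δ := by
        rw [abs_lt]
        constructor <;> linarith [hu.1, hv.2]
      have hclose : ‖(S n).refl t - (S n).refl s‖ ≤ δ / 4 ∧ ‖w t - w s‖ ≤ δ / 4 := by
        rcases le_total t s with hle | hle
        · rw [norm_sub_rev, norm_sub_rev (w t)]
          have hno : ∀ m ≤ max m₁ m₂, ∀ q ∈ P m, q ∉ Ioc t s := fun m hm q hq hqI =>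
            hnone m hm q hq ⟨htu.trans hqI.1, hqI.2.trans hv.1.le⟩
          exact ⟨(DiscreteSolution.norm_refl_sub_le ht.1 hle).trans (hm₁ n hnm t s ht.1 hle hsT.le
            (hno _ (le_max_left _ _))), (hm₂ t ht s hsI hle (hno _ (le_max_right _ _))).1⟩
        · have hno : ∀ m ≤ max m₁ m₂, ∀ q ∈ P m, q ∉ Ioc s t := fun m hm q hq hqI =>
            hnone m hm q hq ⟨hu.2.trans hqI.1, hqI.2.trans htv⟩
          exact ⟨(DiscreteSolution.norm_refl_sub_le hs0.le hle).trans (hm₁ n hnm s t hs0.le hle ht.2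
            (hno _ (le_max_left _ _))), (hm₂ s hsI t ht hle (hno _ (le_max_right _ _))).1⟩
      refine hdir t ((S n).x (k + 1)) γ ⟨ht, hrefl.1, hγ.1⟩ hts ?_ (norm_of_mem_unitVectors hγ)
      have heq : (S n).x (k + 1) - (w s + l s) = (w t - w s) + ((S n).refl t - (S n).refl s) +
          ((S n).refl s - l s) := by
        rw [hdec, hl]; abel
      rw [heq]
      rw [dist_eq_norm] at hn
      refine (norm_add₃_le).trans_lt ?_
      linarith [hclose.1, hclose.2])
  have hcomp := hA.comparable n u v hu0 huv hvI.2.le (hnone 0 (Nat.zero_le _))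
  refine (infDist_le_dist_of_mem hp).trans ?_
  rw [dist_eq_norm]
  refine hpn.trans ?_
  have hvar : (S n).variation u v ≤ ‖(S n).refl v - (S n).refl u‖ / a := by
    rw [le_div_iff₀ ha, mul_comm]; exact hcomp
  calc κ * (S n).variation u v ≤ κ * (‖(S n).refl v - (S n).refl u‖ / a) := by gcongr
    _ = κ / a * ‖(S n).refl v - (S n).refl u‖ := by ring

/-- Almost everywhere with respect to the variation of the limit, the position is on the boundary
and the polar direction belongs to the cone. -/
theorem ae_mem_coneGraph (hA : IsApproximation a b P S) [U.NeBot] (hU : U ≤ atTop) (hT : 0 ≤ T)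
    (hΓ : ∀ t ∈ Icc 0 T, ∀ z ∈ bdry D t, IsClosedConvexCone (Γ t z)) (ha : 0 < a)
    (hclosed : IsClosed (coneGraph T D Γ))
    (hlim : ∀ t ∈ Icc 0 T, Tendsto (fun n => (S n).refl t) U (𝓝 (l t)))
    (hclip : ∀ t, l (clip T t) = l t) {γ : ℝ → Euc d}
    (hγ : Integrable γ (variationMeasure T l))
    (hγI : ∀ s t, s ≤ t → ∫ r in Ioc s t, γ r ∂(variationMeasure T l) =
      l (clip T t) - l (clip T s))
    (hγ1 : ∀ᵐ s ∂(variationMeasure T l), ‖γ s‖ = 1) :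
    ∀ᵐ s ∂(variationMeasure T l), (s, w s + l s, γ s) ∈ coneGraph T D Γ := by
  have hbv := hA.boundedVariationOn hlim hT
  have hrc := (hA.isCadlag hU hlim).right_continuous
  have := isFiniteMeasure_variationMeasure hT hbv hrc
  set μ := variationMeasure T l with hμ
  have hpos : ∀ᵐ s ∂μ, 0 < s := by
    rw [ae_iff]
    simpa only [not_lt] using! variationMeasure_Iic_zero hT hbv hrc
  have hle : ∀ᵐ s ∂μ, s ≤ T := by
    rw [ae_iff]
    simpa only [not_le] using! variationMeasure_Ioi_right hT hbv hrc
  have hatom : ∀ᵐ s ∂μ, ∀ m, s ∈ P m → μ {s} ≠ 0 := by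
    rw [ae_all_iff]
    intro m
    rw [ae_iff]
    refine measure_mono_null (t := ⋃ s ∈ {s | s ∈ P m ∧ μ {s} = 0}, {s}) ?_ ?_
    · intro s hs
      simp only [mem_ofPred_eq, Classical.not_imp, not_not] at hs
      exact mem_biUnion (show s ∈ {s | s ∈ P m ∧ μ {s} = 0} from hs) rfl
    · refine (measure_biUnion_null_iff ((P m).finite_toSet.subset fun s hs => hs.1).countable).2 ?_
      exact fun s hs => hs.2
  filter_upwards [hpos, hle, hatom, hγ1, ae_mem_of_setIntegral_Ioc_mem hγ] with s hs0 hsT hsat hs1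
    hsG
  have hne : γ s ≠ 0 := by
    rw [← norm_ne_zero_iff, hs1]; exact one_ne_zero
  by_cases hsP : ∃ m, s ∈ P m
  · obtain ⟨m, hm⟩ := hsP
    have hμs : 0 < μ.real {s} := ENNReal.toReal_pos (hsat m hm) (measure_ne_top _ _)
    have h1 := tendsto_setIntegral_Ioc hγ s s
    rw [Icc_self, integral_singleton] at h1
    have hstep : ∀ n : ℕ, (0 : ℝ) < 1 / ((n : ℝ) + 1) := fun n => by positivity
    have hmem := hA.mem_coneGraph_of_jump (y := μ.real {s} • γ s) hU hclosed hlim hm hs0 hsT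
      (smul_ne_zero hμs.ne' hne) (u := fun n => s - 1 / ((n : ℝ) + 1))
      (fun n => by linarith [hstep n])
      (by simpa using (tendsto_one_div_add_atTop_nhds_zero_nat (𝕜 := ℝ)).const_sub s)
      (h1.congr fun n => by rw [hγI _ _ (by linarith [hstep n]), hclip, hclip])
    refine ⟨hmem.1, hmem.2.1, ?_⟩
    have h2 := (hΓ _ hmem.1 _ hmem.2.1).smul_mem (inv_nonneg.2 hμs.le) hmem.2.2
    rwa [smul_smul, inv_mul_cancel₀ hμs.ne', one_smul] at h2
  · push Not at hsP
    have hsT' : s < T := hsT.lt_of_ne fun heq => hsP 0 (heq ▸ hA.right_mem)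
    obtain ⟨K, hK, hK1, hK2⟩ := exists_cone_over hΓ s (w s + l s)
    refine hK2 _ ?_ hne
    have hinf : ∀ κ > 0, infDist (γ s) K ≤ κ / a := by
      intro κ hκ
      obtain ⟨δ, hδ, hδK⟩ := hA.exists_infDist_sub_le hU hΓ ha hclosed hlim hsP hs0 hsT' hK hK1 hκ
      have := hsG {y | infDist y K ≤ κ / a * ‖y‖}
        (isClosed_le (continuous_infDist_pt K) (continuous_const.mul continuous_norm))
        (fun c hc y hy => hK.infDist_smul_le hc hy) ⟨δ, hδ, fun u hu v hv => by
          rw [mem_ofPred_eq, hγI u v (hu.2.trans hv.1).le, hclip, hclip]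
          exact hδK u hu v hv⟩
      rw [mem_ofPred_eq, hs1, mul_one] at this
      exact this
    have hzero : infDist (γ s) K = 0 := by
      refine le_antisymm (le_of_forall_pos_le_add fun κ hκ => ?_) infDist_nonneg
      have := hinf (a * κ) (by positivity)
      rw [mul_div_cancel_left₀ _ ha.ne'] at this
      linarith
    exact (hK.closed.mem_iff_infDist_zero hK.nonempty).2 hzero

end IsApproximation

/-! ### Existence of solutions -/

theorem IsTimeDependentDomain.isOpen_slice {T : ℝ} {D : Set (ℝ × Euc d)}
    (hD : IsTimeDependentDomain T D) {t : ℝ} (ht : t ∈ Icc 0 T) : IsOpen (slice D t) := by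
  obtain ⟨D', hD'o, -, rfl⟩ := hD.exists_open
  have : slice (D' ∩ Icc 0 T ×ˢ univ) t = (fun z : Euc d => (t, z)) ⁻¹' D' := by
    ext z
    exact ⟨fun hz => hz.1, fun hz => ⟨hz, ht, mem_univ _⟩⟩
  rw [this]
  exact hD'o.preimage (by fun_prop)

/-- The limit of an approximating sequence solves the Skorohod problem. -/
theorem IsApproximation.exists_isSkorohodSolution {T : ℝ} {D : Set (ℝ × Euc d)}
    {Γ : ℝ → Euc d → Set (Euc d)} {w : ℝ → Euc d} {h a b c : ℝ} {P : ℕ → Finset ℝ}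
    {S : ℕ → DiscreteSolution T D Γ w h} (hA : IsApproximation a b P S) (hT : 0 < T)
    (hD : IsTimeDependentDomain T D) (hl : Tendsto (timeModulus T D) (𝓝[>] 0) (𝓝 0))
    (hΓ : ∀ t ∈ Icc 0 T, ∀ z ∈ bdry D t, IsClosedConvexCone (Γ t z))
    (hclosed : IsClosed (coneGraph T D Γ)) (ha : 0 < a) (hw : IsCadlag T w)
    (hc : ∀ t ∈ Ioc 0 T, ∀ y, Tendsto w (𝓝[<] t) (𝓝 y) → ‖w t - y‖ ≤ c) {ρ : ℝ}
    (hρ : c + b < ρ) :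
    ∃ x l : ℝ → Euc d, IsSkorohodSolution T D Γ w x l ∧ IsCadlagWithJumpsBelow T ρ x := by
  obtain ⟨l, hclip, hlim⟩ := hA.exists_limit hT.le
  have hU : ((hyperfilter ℕ : Ultrafilter ℕ) : Filter ℕ) ≤ atTop := Nat.hyperfilter_le_atTop
  have hbv := hA.boundedVariationOn hlim hT.le
  have hcad := hA.isCadlag hU hlim
  have hx := hw.add hcad
  have h0 : (0 : ℝ) ∈ Icc 0 T := ⟨le_rfl, hT.le⟩
  have hl0 : l 0 = 0 := by
    refine tendsto_nhds_unique (hlim 0 h0) ?_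
    simp only [DiscreteSolution.refl_zero]
    exact tendsto_const_nhds
  obtain ⟨γ, hγ, hγI, hγ1⟩ := exists_polar hT.le hbv hcad.right_continuous
  have hae := hA.ae_mem_coneGraph hU hT.le hΓ ha hclosed hlim hclip hγ hγI hγ1
  refine ⟨fun t => w t + l t, l, ⟨hx, hbv, fun t _ => rfl,
    fun t ht => hA.mem_closure hU hl hlim ht, ⟨γ, hγ.integrableOn, fun t ht => ?_, ?_⟩, ?_⟩,
    hx, c + b, hρ, fun t ht y hy => ?_⟩
  · have hzero : variationMeasure T l {0} = 0 :=
      measure_mono_null (singleton_subset_iff.2 self_mem_Iic)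
        (variationMeasure_Iic_zero hT.le hbv hcad.right_continuous)
    rw [integral_Icc_eq_integral_Ioc' hzero, hγI 0 t ht.1, clip_of_mem ht, clip_of_mem h0, hl0,
      sub_zero]
  · refine ae_restrict_of_ae ?_
    filter_upwards [hae, hγ1] with s hs hs1 _
    exact ⟨hs.2.2, by rwa [mem_sphere_zero_iff_norm]⟩
  · refine measure_mono_null (t := {t | ¬ (t, w t + l t, γ t) ∈ coneGraph T D Γ}) ?_ hae
    rintro t ⟨ht, htD⟩ hmem
    -- the time sections are open, so boundary points do not belong to `D`
    have hb : w t + l t ∈ frontier (slice D t) := hmem.2.1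
    rw [(hD.isOpen_slice ht).frontier_eq] at hb
    exact hb.2 htD
  · obtain ⟨y₁, hy₁⟩ := hw.left_limit t ht
    obtain ⟨y₂, hy₂⟩ := hcad.left_limit t ht
    obtain rfl := tendsto_nhds_unique hy (hy₁.add hy₂)
    rw [add_sub_add_comm]
    exact (norm_add_le _ _).trans
      (add_le_add (hc t ht y₁ hy₁) (hA.norm_sub_left_limit_le hlim ht hy₂))

end Skorohod

end

theorem theorem1 {d : ℕ} (hd : 1 ≤ d) (T : ℝ) (hT : 0 < T)
    (D : Set (ℝ × Skorohod.Euc d)) (hD : Skorohod.IsTimeDependentDomain T D)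
    (hl : Tendsto (Skorohod.timeModulus T D) (𝓝[>] 0) (𝓝 0))
    (r₀ : ℝ) (hsphere : Skorohod.UniformExteriorSphere T r₀ D)
    (Γ : ℝ → Skorohod.Euc d → Set (Skorohod.Euc d))
    (hΓ : ∀ t ∈ Icc 0 T, ∀ z ∈ Skorohod.bdry D t, Skorohod.IsClosedConvexCone (Γ t z))
    (hΓ_opp : Skorohod.NoOppositeVectors T D Γ)
    (hΓ_closed : IsClosed (Skorohod.coneGraph T D Γ))
    (hΓ_cont : Skorohod.ConesContinuous T D Γ)
    (ρ₀ η₀ a e : ℝ) (hρ₀ : 0 < ρ₀) (hρ₀r₀ : ρ₀ < r₀) (hη₀ : 0 < η₀)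
    (ha : IsGLB (Skorohod.boundaryValues T D
      (fun s z => Skorohod.aCoeff D Γ s z ρ₀ η₀)) a) (ha_pos : 0 < a)
    (he : IsLUB (Skorohod.boundaryValues T D
      (fun s z => Skorohod.eCoeff D Γ s z ρ₀ η₀)) e) (he_lt : e < 1)
    (δ₀ h₀ : ℝ) (hδ₀ : 0 < δ₀) (hδ₀ρ₀ : δ₀ < ρ₀) (hh₀ : 1 < h₀)
    (hproj : Skorohod.GoodProjections T δ₀ h₀ D Γ)
    (w : ℝ → Skorohod.Euc d)
    (hw : Skorohod.IsCadlagWithJumpsBelow T (min (δ₀ / 4) (ρ₀ / (4 * h₀))) w)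
    (hw₀ : w 0 ∈ closure (Skorohod.slice D 0)) :
    ∃ x l : ℝ → Skorohod.Euc d,
      Skorohod.IsSkorohodSolution T D Γ w x l ∧ Skorohod.IsCadlagWithJumpsBelow T ρ₀ x := by
  obtain ⟨hw, c, hc, hcw⟩ := hw
  obtain ⟨y, hy⟩ := hw.left_limit T ⟨hT, le_rfl⟩
  have hc0 : 0 ≤ c := (norm_nonneg _).trans (hcw T ⟨hT, le_rfl⟩ y hy)
  have hh₀' : 0 < h₀ := one_pos.trans hh₀
  have hcδ : c < δ₀ := by linarith [hc.trans_le (min_le_left _ _)]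
  have hcρ : c < ρ₀ / (4 * h₀) := hc.trans_le (min_le_right _ _)
  have hcρ' : c < ρ₀ / 4 := hcρ.trans_le (by gcongr; linarith)
  obtain ⟨P, S, hA⟩ := Skorohod.exists_isApproximation hT hl hΓ hρ₀ hη₀
    (Skorohod.uniformInteraction hd ha.1 ha_pos he.1) ha_pos he_lt hh₀' hproj hw hc0 hcw hcδ hcρ hw₀
  exact hA.exists_isSkorohodSolution hT hD hl hΓ hΓ_closed ha_pos hw hcw (by linarith)
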